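/- All manifolds are smooth, finite-dimensional, Hausdorff, second countable and without boundary. Definitions. A $\mathfrak{Q}$-structure $\mathcal{Q}=(N,g_N,\mathcal{I},\theta)$ consists of a connected pseudo-Riemannian manifold $(N,g_N)$, a connected Lie group $\mathcal{I}$ acting smoothly, transitively and effectively on $(N,g_N)$ by isometries, and a smooth $\mathcal{I}$-invariant $1$-form $\theta$ on $N$. For $t\in\mathbb{R}$ let $\mathcal{M}_{t,\mathcal{Q}}=(\mathbb{R}\times N,g_{t,\mathcal{Q}})$, where $g_{t,\mathcal{Q}}=e^{tx}(dx^2+dx\circ\theta+g_N)$ and $dx\circ\theta=dx\otimes\theta+\theta\otimes dx$. Write $g_N(\theta,\theta)$ for the square of the length of $\theta$ in the dual metric. Let $\mathcal{M}=(M,g)$ be a pseudo-Riemannian manifold. A homothety of $\mathcal{M}$ is a diffeomorphism $T$ of $M$ with $T^*g=r^2g$ for some constant $r>0$; $\mathcal{M}$ is homothety homogeneous if its homotheties act transitively. If $\mathcal{H}$ is a connected Lie group acting smoothly, effectively and transitively on $M$ by homotheties, its homothety character is the smooth homomorphism $\lambda:\mathcal{H}\to\mathbb{R}^+$ with $\Phi^*g=\lambda(\Phi)^2g$.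 The sequence $1\to\ker\lambda\to\mathcal{H}\to\mathbb{R}^+\to1$ splits if there is an isomorphism of Lie groups $\mathcal{H}\cong\mathbb{R}^+\times\ker\lambda$ under which $\lambda$ is the projection on the first factor; a splitting yields the central $1$-parameter subgroup $\Phi_s\leftrightarrow(e^s,1)$ of $\mathcal{H}$ and its generating homothety vector field $\xi(p)=\frac{d}{ds}\big|_{s=0}\Phi_s p$ on $M$. $\mathcal{M}$ is VSI if all Weyl scalar invariants (the linear combinations of complete contractions of non-empty products of covariant derivatives $\nabla^kR$, $k\ge0$, of the curvature tensor) vanish identically. Theorem. (1) Let $\mathcal{Q}=(N,g_N,\mathcal{I},\theta)$ be a $\mathfrak{Q}$-structure and let $t\in\mathbb{R}$. Then $g_{t,\mathcal{Q}}$ is non-degenerate if and only if $g_N(\theta,\theta)\ne1$ (at every point of $N$). If $g_N(\theta,\theta)\neq1$, then $\mathcal{M}_{t,\mathcal{Q}}$ is a homothety homogeneous pseudo-Riemannian manifold and, if moreover $t\ne0$, there is a connected Lie group acting smoothly, effectively and transitively on it by homotheties whose homothety character $\lambda$ is non-trivial and for which the sequence defined by $\lambda$ splits. (2) Let $\mathcal{M}=(M,g)$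 be a connected Riemannian manifold which is not VSI, and let $\mathcal{H}$ be a connected Lie group acting smoothly, effectively and transitively on $M$ by homotheties, with non-trivial homothety character $\lambda$. Suppose that the sequence defined by $\lambda$ splits and that the vector field $\xi$ of a splitting is spacelike ($g(\xi,\xi)>0$ at every point). Then there are a $\mathfrak{Q}$-structure $\mathcal{Q}=(N,g_N,\mathcal{I},\theta)$ and a real number $t\ne0$ such that $g_N(\theta,\theta)\neq1$ (at every point of $N$) and $\mathcal{M}$ is isometric to $\mathcal{M}_{t,\mathcal{Q}}$. -/

import Mathlib

open scoped Manifold ContDiff Bundle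
open Bundle

universe u

noncomputable section

/-! ### Fields of bilinear forms, pseudo-Riemannian metrics, homotheties -/

section Metrics

variable {E : Type*} [NormedAddCommGroup E] [NormedSpace ℝ E]
  {X : Type*} [TopologicalSpace X] (J : ModelWithCorners ℝ E X)
  (M : Type*) [TopologicalSpace M] [ChartedSpace X M]

/-- A (not necessarily smooth or symmetric) field of bilinear forms on the tangent spaces of `M`. -/
abbrev BilinField : Type _ := ∀ x : M, TangentSpace J x →L[ℝ] TangentSpace J x →L[ℝ] ℝ

/-- A (not necessarily smooth) field of covectors on `M`. -/
abbrev CovectorField : Type _ := ∀ x : M, TangentSpace J x →L[ℝ] ℝ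

variable {J M}

/-- All the bilinear forms of the field are non-degenerate. -/
def BilinField.Nondegenerate (g : BilinField J M) : Prop :=
  ∀ (x : M) (v : TangentSpace J x), (∀ w : TangentSpace J x, g x v w = 0) → v = 0

/-- `g` is a smooth pseudo-Riemannian metric (of arbitrary signature). -/
structure BilinField.IsPseudoRiemannian [IsManifold J ∞ M] (g : BilinField J M) : Prop where
  smooth : ContMDiff J (J.prod 𝓘(ℝ, E →L[ℝ] E →L[ℝ] ℝ)) ∞
    (fun x ↦ TotalSpace.mk' (E →L[ℝ] E →L[ℝ] ℝ)
      (E := fun x : M ↦ TangentSpace J x →L[ℝ] TangentSpace J x →L[ℝ] ℝ) x (g x))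
  symm : ∀ (x : M) (v w : TangentSpace J x), g x v w = g x w v
  nondegenerate : g.Nondegenerate

/-- `g` is a smooth Riemannian metric. -/
structure BilinField.IsRiemannian [IsManifold J ∞ M] (g : BilinField J M) : Prop
    extends g.IsPseudoRiemannian where
  pos : ∀ (x : M) (v : TangentSpace J x), v ≠ 0 → 0 < g x v v

/-- `θ` is a smooth `1`-form. -/
def CovectorField.IsSmooth [IsManifold J ∞ M] (θ : CovectorField J M) : Prop :=
  ContMDiff J (J.prod 𝓘(ℝ, E →L[ℝ] ℝ)) ∞
    (fun x ↦ TotalSpace.mk' (E →L[ℝ] ℝ) (E := fun x : M ↦ TangentSpace J x →L[ℝ] ℝ) x (θ x))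

/-- The squared length `g(θ, θ)` of the covector `θ x` for the metric dual to `g x`: it is
`θ (θ♯)`, where `θ♯` is the preimage of `θ` under the isomorphism `v ↦ g(v, ·)`. -/
def BilinField.dualNormSq (g : BilinField J M) (θ : CovectorField J M) (x : M) : ℝ :=
  θ x ((g x).inverse (θ x))

/-- `T^* g' = c • g`. -/
def IsHomothetyWith {E' : Type*} [NormedAddCommGroup E'] [NormedSpace ℝ E']
    {X' : Type*} [TopologicalSpace X'] {J' : ModelWithCorners ℝ E' X'}
    {M' : Type*} [TopologicalSpace M'] [ChartedSpace X' M']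
    (g : BilinField J M) (g' : BilinField J' M') (T : M → M') (c : ℝ) : Prop :=
  ∀ (x : M) (v w : TangentSpace J x),
    g' (T x) (mfderiv J J' T x v) (mfderiv J J' T x w) = c * g x v w

/-- The homotheties of `(M, g)`, i.e. the diffeomorphisms `T` of `M` with `T^* g = r² g` for some
`r > 0`, act transitively on `M`. -/
def IsHomothetyHomogeneous (g : BilinField J M) : Prop :=
  ∀ x y : M, ∃ T : Diffeomorph J J M M ∞, (∃ r : ℝ, 0 < r ∧ IsHomothetyWith g g T (r ^ 2)) ∧ T x = y

/-- Two manifolds with metrics are isometric. -/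
def AreIsometric {E' : Type*} [NormedAddCommGroup E'] [NormedSpace ℝ E']
    {X' : Type*} [TopologicalSpace X'] {J' : ModelWithCorners ℝ E' X'}
    {M' : Type*} [TopologicalSpace M'] [ChartedSpace X' M']
    (g : BilinField J M) (g' : BilinField J' M') : Prop :=
  ∃ T : Diffeomorph J J' M M' ∞, IsHomothetyWith g g' T 1

end Metrics

/-! ### Curvature, its covariant derivatives and Weyl scalar invariants -/

section Curvature

variable {E : Type*} [NormedAddCommGroup E] [NormedSpace ℝ E]

/-- For a metric `G` on (an open subset of) the vector space `E`: the Levi-Civita derivative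
`∇_u v` of the constant vector field `v` in the direction `u`, given by the Koszul formula
`2 G(∇_u v, w) = u G(v, w) + v G(u, w) - w G(u, v)`. -/
def christoffel (G : E → E →L[ℝ] E →L[ℝ] ℝ) (y u v : E) : E :=
  (G y).inverse ((1 / 2 : ℝ) •
    (fderiv ℝ G y u v + fderiv ℝ G y v u - ((fderiv ℝ G y).flip u).flip v))

/-- The curvature operator `R(u, v) w = ∇_u ∇_v w - ∇_v ∇_u w` on constant vector fields. -/
def curvatureOp (G : E → E →L[ℝ] E →L[ℝ] ℝ) (y u v w : E) : E :=
  fderiv ℝ (fun z ↦ christoffel G z v w) y u + christoffel G y u (christoffel G y v w)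
    - (fderiv ℝ (fun z ↦ christoffel G z u w) y v + christoffel G y v (christoffel G y u w))

/-- The covariant derivative of a covariant tensor field of rank `r`; the new last slot is the
direction of differentiation. -/
def covDeriv (G : E → E →L[ℝ] E →L[ℝ] ℝ) {r : ℕ} (T : E → (Fin r → E) → ℝ) :
    E → (Fin (r + 1) → E) → ℝ :=
  fun y v ↦ fderiv ℝ (fun z ↦ T z (Fin.init v)) y (v (Fin.last r))
    - ∑ a : Fin r, T y (Function.update (Fin.init v) a
        (christoffel G y (v (Fin.last r)) (v a.castSucc)))

/-- The `k`-th covariant derivative `∇^k R` of the curvature tensor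
`R(x₁, x₂, x₃, x₄) = G(R(x₁, x₂) x₃, x₄)`. -/
def nablaCurvature (G : E → E →L[ℝ] E →L[ℝ] ℝ) : (k : ℕ) → E → (Fin (4 + k) → E) → ℝ
  | 0 => fun y v ↦ G y (curvatureOp G y (v 0) (v 1) (v 2)) (v 3)
  | k + 1 => covDeriv G (nablaCurvature G k)

variable [FiniteDimensional ℝ E]

/-- A complete contraction of the tensor `∇^{k 0} R ⊗ ⋯ ⊗ ∇^{k (s-1)} R`. The bijection `σ` sorts
the index slots of the tensor into `r` pairs `{(a, false), (a, true)}`, and the two slots of each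
pair are contracted by means of the inverse metric
`g^{ij} = (b.coord i) (G⁻¹ (b.coord j))` in a basis `b` of `E`. -/
def weylContraction (G : E → E →L[ℝ] E →L[ℝ] ℝ) {s r : ℕ} (k : Fin s → ℕ)
    (σ : (Σ j : Fin s, Fin (4 + k j)) ≃ Fin r × Bool) (y : E) : ℝ :=
  let b := Module.finBasis ℝ E
  let coord (i : Fin (Module.finrank ℝ E)) : E →L[ℝ] ℝ := LinearMap.toContinuousLinearMap (b.coord i)
  ∑ c : Fin r × Bool → Fin (Module.finrank ℝ E),
    (∏ a : Fin r, coord (c (a, false)) ((G y).inverse (coord (c (a, true))))) *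
      ∏ j : Fin s, nablaCurvature G (k j) y (fun i ↦ b (c (σ ⟨j, i⟩)))

variable {M : Type*} [TopologicalSpace M] [ChartedSpace E M]

/-- The expression of `g` in the preferred chart at `p`. -/
def BilinField.inChart (g : BilinField 𝓘(ℝ, E) M) (p : M) (y : E) : E →L[ℝ] E →L[ℝ] ℝ :=
  let ψ : E → M := (extChartAt 𝓘(ℝ, E) p).symm
  let B : E →L[ℝ] E →L[ℝ] ℝ := g (ψ y)
  let D : E →L[ℝ] E := mfderiv 𝓘(ℝ, E) 𝓘(ℝ, E) ψ y
  B.bilinearComp D D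

/-- `(M, g)` is VSI: all Weyl scalar invariants vanish identically. As the Weyl scalar invariants
are the linear combinations of complete contractions of (non-empty) products of covariant
derivatives of the curvature tensor, it is enough to ask this of the complete contractions. -/
def BilinField.IsVSI (g : BilinField 𝓘(ℝ, E) M) : Prop :=
  ∀ (s r : ℕ) (_ : 0 < s) (k : Fin s → ℕ) (σ : (Σ j : Fin s, Fin (4 + k j)) ≃ Fin r × Bool) (p : M),
    weylContraction (g.inChart p) k σ (extChartAt 𝓘(ℝ, E) p p) = 0

end Curvature

/-! ### Transitive groups of homotheties -/

/-- The multiplicative group `ℝ⁺` (with Mathlib's group structure on positive elements). -/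
abbrev PosReal : Type := {x : ℝ // 0 < x}

/-- The smooth structure of `ℝ⁺` as an open subset of `ℝ`. -/
instance : ChartedSpace ℝ PosReal :=
  inferInstanceAs (ChartedSpace ℝ (⟨Set.Ioi (0 : ℝ), isOpen_Ioi⟩ : TopologicalSpace.Opens ℝ))

section HomothetyGroups

variable {E : Type*} [NormedAddCommGroup E] [NormedSpace ℝ E]
  {X : Type*} [TopologicalSpace X] {J : ModelWithCorners ℝ E X}
  {M : Type u} [TopologicalSpace M] [ChartedSpace X M]

/-- A connected Lie group `H` of homotheties of `(M, g)` (i.e. a connected Lie group acting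
smoothly and effectively on `M` by homotheties) which acts transitively on `M`, together with its
homothety character `h ↦ λ(h)`, determined by `h^* g = λ(h)² g`. -/
structure HomothetyGroup (g : BilinField J M) where
  F : Type
  [normedAddCommGroup : NormedAddCommGroup F]
  [normedSpace : NormedSpace ℝ F]
  [finiteDimensional : FiniteDimensional ℝ F]
  H : Type u
  [group : Group H]
  [topologicalSpace : TopologicalSpace H]
  [chartedSpace : ChartedSpace F H]
  [lieGroup : LieGroup 𝓘(ℝ, F) ∞ H]
  [connectedSpace : ConnectedSpace H]
  [mulAction : MulAction H M]
  [contMDiffSMul : ContMDiffSMul 𝓘(ℝ, F) J ∞ H M]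
  [isPretransitive : MulAction.IsPretransitive H M]
  [faithfulSMul : FaithfulSMul H M]
  char : H →* PosReal
  contMDiff_char : ContMDiff 𝓘(ℝ, F) 𝓘(ℝ, ℝ) ∞ char
  homothety : ∀ h : H, IsHomothetyWith g g (fun x ↦ h • x) ((char h : ℝ) ^ 2)

attribute [instance] HomothetyGroup.normedAddCommGroup HomothetyGroup.normedSpace
  HomothetyGroup.finiteDimensional HomothetyGroup.group HomothetyGroup.topologicalSpace
  HomothetyGroup.chartedSpace HomothetyGroup.lieGroup HomothetyGroup.connectedSpace
  HomothetyGroup.mulAction HomothetyGroup.contMDiffSMul HomothetyGroup.isPretransitive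
  HomothetyGroup.faithfulSMul

/-- A splitting of `1 → ker λ → H → ℝ⁺ → 1`: an isomorphism of Lie groups
`H ≅ ℝ⁺ × ker λ` under which `λ` becomes the projection on the first factor. Here `ker λ` is a
Lie group for the topology induced by `H` (its smooth structure is unique). -/
structure HomothetyGroup.Splitting {g : BilinField J M} (𝓗 : HomothetyGroup g) where
  K : Type
  [normedAddCommGroup : NormedAddCommGroup K]
  [normedSpace : NormedSpace ℝ K]
  [finiteDimensional : FiniteDimensional ℝ K]
  [chartedSpace : ChartedSpace K 𝓗.char.ker]
  [lieGroup : LieGroup 𝓘(ℝ, K) ∞ 𝓗.char.ker]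
  iso : 𝓗.H ≃* PosReal × 𝓗.char.ker
  contMDiff_iso : ContMDiff 𝓘(ℝ, 𝓗.F) (𝓘(ℝ, ℝ).prod 𝓘(ℝ, K)) ∞ iso
  contMDiff_iso_symm : ContMDiff (𝓘(ℝ, ℝ).prod 𝓘(ℝ, K)) 𝓘(ℝ, 𝓗.F) ∞ iso.symm
  fst_iso : ∀ h : 𝓗.H, (iso h).1 = 𝓗.char h

/-- The `1`-parameter subgroup `s ↦ Φ_s` of `H` with `λ(Φ_s) = e^s` defined by a splitting; it is
central in `H`. -/
def HomothetyGroup.Splitting.flow {g : BilinField J M} {𝓗 : HomothetyGroup g}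
    (S : 𝓗.Splitting) (s : ℝ) : 𝓗.H :=
  S.iso.symm (⟨Real.exp s, Real.exp_pos s⟩, 1)

/-- The homothety vector field `ξ` on `M` generating the central `1`-parameter group of a
splitting, `ξ(x) = d/ds (Φ_s x)` at `s = 0`. -/
def HomothetyGroup.Splitting.generator {g : BilinField J M} {𝓗 : HomothetyGroup g}
    (S : 𝓗.Splitting) (x : M) : TangentSpace J x :=
  (mfderiv 𝓘(ℝ, ℝ) J (fun s : ℝ ↦ S.flow s • x) 0 : ℝ →L[ℝ] E) 1

/-- The generator `ξ` is spacelike everywhere. -/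
def HomothetyGroup.Splitting.IsSpacelike {g : BilinField J M} {𝓗 : HomothetyGroup g}
    (S : 𝓗.Splitting) : Prop :=
  ∀ x : M, 0 < g x (S.generator x) (S.generator x)

end HomothetyGroups

/-! ### `𝔔`-structures -/

/-- The symmetric bilinear form `c (dx² + dx ∘ α + B)` on `ℝ × V`, where
`dx ∘ α = dx ⊗ α + α ⊗ dx`; see `productForm_apply`. -/
def productForm {V : Type*} [NormedAddCommGroup V] [NormedSpace ℝ V] (c : ℝ)
    (α : V →L[ℝ] ℝ) (B : V →L[ℝ] V →L[ℝ] ℝ) : ℝ × V →L[ℝ] ℝ × V →L[ℝ] ℝ :=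
  let dx : ℝ × V →L[ℝ] ℝ := ContinuousLinearMap.fst ℝ ℝ V
  let pr : ℝ × V →L[ℝ] V := ContinuousLinearMap.snd ℝ ℝ V
  c • (dx.smulRight dx + (dx.smulRight (α.comp pr) + (α.comp pr).smulRight dx)
    + B.bilinearComp pr pr)

theorem productForm_apply {V : Type*} [NormedAddCommGroup V] [NormedSpace ℝ V] (c : ℝ)
    (α : V →L[ℝ] ℝ) (B : V →L[ℝ] V →L[ℝ] ℝ) (a b : ℝ) (v w : V) :
    productForm c α B (a, v) (b, w) = c * (a * b + (a * α w + b * α v) + B v w) := by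
  change c * (a * b + (a * α w + α v * b) + B v w) = _
  rw [mul_comm b]

/-- A `𝔔`-structure `(N, g, G, θ)`: a connected Lie group `G` acting smoothly, transitively and
effectively by isometries on a connected pseudo-Riemannian manifold `(N, g)`, and a smooth
`G`-invariant `1`-form `θ` on `N`. -/
structure QStructure where
  E : Type
  [normedAddCommGroupE : NormedAddCommGroup E]
  [normedSpaceE : NormedSpace ℝ E]
  [finiteDimensionalE : FiniteDimensional ℝ E]
  N : Type u
  [topologicalSpaceN : TopologicalSpace N]
  [chartedSpaceN : ChartedSpace E N]
  [isManifoldN : IsManifold 𝓘(ℝ, E) ∞ N]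
  [t2SpaceN : T2Space N]
  [secondCountableTopologyN : SecondCountableTopology N]
  [connectedSpaceN : ConnectedSpace N]
  g : BilinField 𝓘(ℝ, E) N
  isPseudoRiemannian : g.IsPseudoRiemannian
  F : Type
  [normedAddCommGroupF : NormedAddCommGroup F]
  [normedSpaceF : NormedSpace ℝ F]
  [finiteDimensionalF : FiniteDimensional ℝ F]
  G : Type u
  [groupG : Group G]
  [topologicalSpaceG : TopologicalSpace G]
  [chartedSpaceG : ChartedSpace F G]
  [lieGroupG : LieGroup 𝓘(ℝ, F) ∞ G]
  [connectedSpaceG : ConnectedSpace G]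
  [mulAction : MulAction G N]
  [contMDiffSMul : ContMDiffSMul 𝓘(ℝ, F) 𝓘(ℝ, E) ∞ G N]
  [isPretransitive : MulAction.IsPretransitive G N]
  [faithfulSMul : FaithfulSMul G N]
  isometry : ∀ a : G, IsHomothetyWith g g (fun x ↦ a • x) 1
  θ : CovectorField 𝓘(ℝ, E) N
  smooth_θ : θ.IsSmooth
  invariant_θ : ∀ (a : G) (x : N) (v : TangentSpace 𝓘(ℝ, E) x),
    θ (a • x) (mfderiv 𝓘(ℝ, E) 𝓘(ℝ, E) (fun y ↦ a • y) x v) = θ x v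

namespace QStructure

attribute [instance] normedAddCommGroupE normedSpaceE finiteDimensionalE topologicalSpaceN
  chartedSpaceN isManifoldN t2SpaceN secondCountableTopologyN connectedSpaceN
  normedAddCommGroupF normedSpaceF finiteDimensionalF groupG topologicalSpaceG chartedSpaceG
  lieGroupG connectedSpaceG mulAction contMDiffSMul isPretransitive faithfulSMul

/-- The symmetric bilinear form field `e^{tx} (dx² + dx ∘ θ + g)` on `ℝ × N`. -/
def metric (Q : QStructure.{u}) (t : ℝ) : BilinField (𝓘(ℝ, ℝ).prod 𝓘(ℝ, Q.E)) (ℝ × Q.N) :=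
  fun p ↦ productForm (V := Q.E) (Real.exp (t * p.1)) (Q.θ p.2) (Q.g p.2)

end QStructure

end

noncomputable section

/-!
Part (1) is fibrewise linear algebra: with `θ♯` dual to `θ`, the vector `∂ₓ - θ♯` is orthogonal to
`N` and has squared length proportional to `1 - g_N(θ, θ)`. The group `ℝ⁺ × G` acts on `ℝ × N` by
translations of `x` and isometries of `N`, and translation by `s` multiplies the metric by `e^{ts}`.

For part (2), `ξ` is invariant under `H` because its flow `Φ` is central, so that
`g(ξ, ξ)(h x) = λ(h)² g(ξ, ξ)(x)`. Hence `N = {g(ξ, ξ) = 1}` is a regular hypersurface on which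
`ker λ` acts transitively by isometries, and every orbit of `Φ` meets `N` exactly once, which makes
`(s, n) ↦ Φ_s n` a diffeomorphism `ℝ × N → M`. As `Φ_s^* g = e^{2s} g` and `g(ξ, ξ) = 1` on `N`, it
pulls `g` back to `e^{2s} (ds² + ds ∘ ξ♭ + g)`, and part (1) turns the non-degeneracy of `g` into
`g_N(ξ♭, ξ♭) ≠ 1`.
-/

section SmoothFields

variable {E : Type*} [NormedAddCommGroup E] [NormedSpace ℝ E]
  {X : Type*} [TopologicalSpace X] {J : ModelWithCorners ℝ E X}
  {M : Type*} [TopologicalSpace M] [ChartedSpace X M]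
  {E' : Type*} [NormedAddCommGroup E'] [NormedSpace ℝ E']
  {X' : Type*} [TopologicalSpace X'] {J' : ModelWithCorners ℝ E' X'}
  {M' : Type*} [TopologicalSpace M'] [ChartedSpace X' M']
  {n : ℕ∞ω}

theorem contMDiffAt_snd_of_trivial {F : Type*} [NormedAddCommGroup F] [NormedSpace ℝ F]
    {b : M' → M} {f : M' → F} {x : M'}
    (h : ContMDiffAt J' (J.prod 𝓘(ℝ, F)) n
      (fun m ↦ TotalSpace.mk' F (E := Bundle.Trivial M F) (b m) (f m)) x) :
    ContMDiffAt J' 𝓘(ℝ, F) n f x :=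
  (contMDiffAt_totalSpace.1 h).2

theorem contMDiffAt_clm_of_apply [FiniteDimensional ℝ E] {F : Type*} [NormedAddCommGroup F]
    [NormedSpace ℝ F] {A : M' → E →L[ℝ] F} {x : M'}
    (h : ∀ v, ContMDiffAt J' 𝓘(ℝ, F) n (fun y ↦ A y v) x) :
    ContMDiffAt J' 𝓘(ℝ, E →L[ℝ] F) n A x := by
  let b := Module.finBasis ℝ E
  let R (i : Fin (Module.finrank ℝ E)) : F →L[ℝ] E →L[ℝ] F :=
    ContinuousLinearMap.smulRightL ℝ E F (LinearMap.toContinuousLinearMap (b.coord i))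
  have hA : A = fun y ↦ ∑ i, R i (A y (b i)) := by
    funext y
    ext v
    conv_lhs => rw [← b.sum_repr v]
    simp only [map_sum, map_smul, sum_apply, R, ContinuousLinearMap.smulRightL_apply_apply]
    rfl
  rw [hA]
  exact contMDiffAt_finsetSum fun i _ ↦ (R i).contDiff.contMDiff.contMDiffAt.comp x (h (b i))

theorem contMDiffAt_snd_of_tangentBundle_vectorSpace {b v : M' → E} {x : M'}
    (h : ContMDiffAt J' 𝓘(ℝ, E).tangent n (fun m ↦ (⟨b m, v m⟩ : TangentBundle 𝓘(ℝ, E) E)) x) :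
    ContMDiffAt J' 𝓘(ℝ, E) n v x := by
  simpa using (contMDiffAt_totalSpace.1 h).2

theorem contMDiffAt_mfderiv_apply [IsManifold J ∞ M] [IsManifold J' ∞ M'] {f : M' → M}
    (hf : ContMDiff J' J ∞ f) {P : Type*} [TopologicalSpace P] {E'' : Type*}
    [NormedAddCommGroup E''] [NormedSpace ℝ E''] {X'' : Type*} [TopologicalSpace X'']
    {J'' : ModelWithCorners ℝ E'' X''} [ChartedSpace X'' P]
    {b : P → M'} {v : ∀ m, TangentSpace J' (b m)} {x : P}
    (hv : ContMDiffAt J'' J'.tangent ∞ (fun m ↦ (⟨b m, v m⟩ : TangentBundle J' M')) x) :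
    ContMDiffAt J'' J.tangent ∞
      (fun m ↦ (⟨f (b m), mfderiv J' J f (b m) (v m)⟩ : TangentBundle J M)) x :=
  ((hf.contMDiff_tangentMap (m := ∞) (by simp)).contMDiffAt).comp x hv

section Prod

variable [IsManifold J ∞ M] [IsManifold J' ∞ M']
  {v : ∀ p : M × M', TangentSpace (J.prod J') p} {p : M × M'}
  (hv : ContMDiffAt (J.prod J') (J.prod J').tangent ∞
    (fun q ↦ (⟨q, v q⟩ : TangentBundle (J.prod J') (M × M'))) p)

include hv

theorem contMDiffAt_fst_vectorField :
    ContMDiffAt (J.prod J') J.tangent ∞ (fun q ↦ (⟨q.1, (v q).1⟩ : TangentBundle J M)) p := by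
  simpa only [mfderiv_fst] using! contMDiffAt_mfderiv_apply contMDiff_fst hv

theorem contMDiffAt_snd_vectorField :
    ContMDiffAt (J.prod J') J'.tangent ∞ (fun q ↦ (⟨q.2, (v q).2⟩ : TangentBundle J' M')) p := by
  simpa only [mfderiv_snd] using! contMDiffAt_mfderiv_apply contMDiff_snd hv

end Prod

variable [IsManifold J ∞ M]

theorem contMDiffAt_trivializationAt_symm (x₀ : M) (v : E) :
    ContMDiffAt J J.tangent ∞ (fun x ↦ (⟨x,
      (trivializationAt E (TangentSpace J : M → Type _) x₀).symm x v⟩ : TangentBundle J M)) x₀ := by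
  let e := trivializationAt E (TangentSpace J : M → Type _) x₀
  have hx₀ : x₀ ∈ e.baseSet := mem_baseSet_trivializationAt E _ x₀
  have ht : (x₀, v) ∈ e.target := e.mem_target.2 hx₀
  have he := (e.contMDiffOn_symm (IB := J) (n := ∞) _ ht).contMDiffAt (e.open_target.mem_nhds ht)
  have hv : ContMDiffAt J (J.prod 𝓘(ℝ, E)) ∞ (fun x : M ↦ (x, v)) x₀ :=
    contMDiffAt_id.prodMk contMDiffAt_const
  refine (he.comp x₀ hv).congr_of_eventuallyEq ?_
  filter_upwards [e.open_baseSet.mem_nhds hx₀] with x hx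
  exact e.mk_symm hx v

theorem CovectorField.isSmooth_of_apply [FiniteDimensional ℝ E] {θ : CovectorField J M}
    (h : ∀ (x₀ : M) (v : ∀ x : M, TangentSpace J x),
      ContMDiffAt J J.tangent ∞ (fun x ↦ (⟨x, v x⟩ : TangentBundle J M)) x₀ →
      ContMDiffAt J 𝓘(ℝ, ℝ) ∞ (fun x ↦ θ x (v x)) x₀) : θ.IsSmooth := by
  intro x₀
  rw [contMDiffAt_hom_bundle]
  refine ⟨contMDiffAt_id, contMDiffAt_clm_of_apply fun v ↦ ?_⟩
  refine (h x₀ _ (contMDiffAt_trivializationAt_symm x₀ v)).congr_of_eventuallyEq ?_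
  have hx₀ := mem_baseSet_trivializationAt E (TangentSpace J : M → Type _) x₀
  filter_upwards [(trivializationAt E (TangentSpace J : M → Type _) x₀).open_baseSet.mem_nhds hx₀]
    with x hx
  simp only [ContinuousLinearMap.inCoordinates, ContinuousLinearMap.comp_apply,
    Trivialization.symmL_apply _ hx]
  simp

theorem CovectorField.IsSmooth.contMDiffAt_apply {θ : CovectorField J M} (hθ : θ.IsSmooth)
    {b : M' → M} {v : ∀ m, TangentSpace J (b m)} {x : M'}
    (hv : ContMDiffAt J' J.tangent ∞ (fun m ↦ (⟨b m, v m⟩ : TangentBundle J M)) x) :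
    ContMDiffAt J' 𝓘(ℝ, ℝ) ∞ (fun m ↦ θ (b m) (v m)) x := by
  have hb : ContMDiffAt J' J ∞ b x := (contMDiffAt_totalSpace.1 hv).1
  exact contMDiffAt_snd_of_trivial (J := J) (b := b)
    (ContMDiffAt.clm_bundle_apply (E₂ := Bundle.Trivial M ℝ) ((hθ (b x)).comp x hb) hv)

/-- Smoothness of a field of bilinear forms, as a section of `Hom(TM, Hom(TM, ℝ))`; this is the
first field of `BilinField.IsPseudoRiemannian`. -/
def BilinField.IsSmooth (g : BilinField J M) : Prop :=
  ContMDiff J (J.prod 𝓘(ℝ, E →L[ℝ] E →L[ℝ] ℝ)) ∞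
    (fun x ↦ TotalSpace.mk' (E →L[ℝ] E →L[ℝ] ℝ)
      (E := fun x : M ↦ TangentSpace J x →L[ℝ] TangentSpace J x →L[ℝ] ℝ) x (g x))

theorem BilinField.IsPseudoRiemannian.isSmooth {g : BilinField J M} (hg : g.IsPseudoRiemannian) :
    g.IsSmooth :=
  hg.smooth

theorem BilinField.isSmooth_of_apply [FiniteDimensional ℝ E] {g : BilinField J M}
    (h : ∀ (x₀ : M) (v w : ∀ x : M, TangentSpace J x),
      ContMDiffAt J J.tangent ∞ (fun x ↦ (⟨x, v x⟩ : TangentBundle J M)) x₀ →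
      ContMDiffAt J J.tangent ∞ (fun x ↦ (⟨x, w x⟩ : TangentBundle J M)) x₀ →
      ContMDiffAt J 𝓘(ℝ, ℝ) ∞ (fun x ↦ g x (v x) (w x)) x₀) : g.IsSmooth := by
  intro x₀
  rw [contMDiffAt_hom_bundle]
  refine ⟨contMDiffAt_id,
    contMDiffAt_clm_of_apply fun v ↦ contMDiffAt_clm_of_apply fun w ↦ ?_⟩
  refine (h x₀ _ _ (contMDiffAt_trivializationAt_symm x₀ v)
    (contMDiffAt_trivializationAt_symm x₀ w)).congr_of_eventuallyEq ?_
  have hx₀ := mem_baseSet_trivializationAt E (TangentSpace J : M → Type _) x₀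
  filter_upwards [(trivializationAt E (TangentSpace J : M → Type _) x₀).open_baseSet.mem_nhds hx₀]
    with x hx
  refine (inCoordinates_apply_eq₂ (ϕ := g x) (v := v) (w := w) (F₃ := ℝ)
    (E₃ := Bundle.Trivial M ℝ) hx hx (Set.mem_univ x)).trans ?_
  simp

theorem BilinField.IsSmooth.contMDiffAt_apply {g : BilinField J M} (hg : g.IsSmooth)
    {b : M' → M} {v w : ∀ m, TangentSpace J (b m)} {x : M'}
    (hv : ContMDiffAt J' J.tangent ∞ (fun m ↦ (⟨b m, v m⟩ : TangentBundle J M)) x)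
    (hw : ContMDiffAt J' J.tangent ∞ (fun m ↦ (⟨b m, w m⟩ : TangentBundle J M)) x) :
    ContMDiffAt J' 𝓘(ℝ, ℝ) ∞ (fun m ↦ g (b m) (v m) (w m)) x := by
  have hb : ContMDiffAt J' J ∞ b x := (contMDiffAt_totalSpace.1 hv).1
  exact contMDiffAt_snd_of_trivial (J := J) (b := b)
    (ContMDiffAt.clm_bundle_apply₂ (E₃ := Bundle.Trivial M ℝ) ((hg (b x)).comp x hb) hv hw)

end SmoothFields

section Pullback

variable {E : Type*} [NormedAddCommGroup E] [NormedSpace ℝ E]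
  {X : Type*} [TopologicalSpace X] {J : ModelWithCorners ℝ E X}
  {M : Type*} [TopologicalSpace M] [ChartedSpace X M]
  {E' : Type*} [NormedAddCommGroup E'] [NormedSpace ℝ E']
  {X' : Type*} [TopologicalSpace X'] {J' : ModelWithCorners ℝ E' X'}
  {M' : Type*} [TopologicalSpace M'] [ChartedSpace X' M']

/-- The pullback `f^* g` of a field of bilinear forms. -/
def BilinField.pullback (J' : ModelWithCorners ℝ E' X') (g : BilinField J M) (f : M' → M) :
    BilinField J' M' :=
  fun x ↦
    let B : E →L[ℝ] E →L[ℝ] ℝ := g (f x)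
    let D : E' →L[ℝ] E := mfderiv J' J f x
    (B.bilinearComp D D : E' →L[ℝ] E' →L[ℝ] ℝ)

theorem BilinField.pullback_apply (g : BilinField J M) (f : M' → M) (x : M')
    (v w : TangentSpace J' x) :
    g.pullback J' f x v w = g (f x) (mfderiv J' J f x v) (mfderiv J' J f x w) := rfl

/-- The pullback `f^* θ` of a field of covectors. -/
def CovectorField.pullback (J' : ModelWithCorners ℝ E' X') (θ : CovectorField J M) (f : M' → M) :
    CovectorField J' M' :=
  fun x ↦ (θ (f x)).comp (mfderiv J' J f x)

theorem CovectorField.pullback_apply (θ : CovectorField J M) (f : M' → M) (x : M')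
    (v : TangentSpace J' x) : θ.pullback J' f x v = θ (f x) (mfderiv J' J f x v) := rfl

theorem mfderiv_surjective_of_diffeomorph (T : Diffeomorph J J' M M' ∞) (x : M) :
    Function.Surjective (mfderiv J J' T x) :=
  (T.mfderivToContinuousLinearEquiv (by simp) x).surjective

theorem BilinField.Nondegenerate.of_isHomothetyWith {g : BilinField J M} {g' : BilinField J' M'}
    (hg' : g'.Nondegenerate) {T : Diffeomorph J J' M M' ∞} {c : ℝ}
    (hT : IsHomothetyWith g g' T c) : g.Nondegenerate := by
  intro x v hv
  have hTv : mfderiv J J' T x v = 0 := hg' _ _ fun w' ↦ by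
    obtain ⟨w, rfl⟩ := mfderiv_surjective_of_diffeomorph T x w'
    rw [hT x v w, hv w, mul_zero]
  exact (T.mfderivToContinuousLinearEquiv (by simp) x).injective (hTv.trans (map_zero _).symm)

theorem AreIsometric.symm {g : BilinField J M} {g' : BilinField J' M'} (h : AreIsometric g g') :
    AreIsometric g' g := by
  obtain ⟨T, hT⟩ := h
  refine ⟨T.symm, fun y v' w' ↦ ?_⟩
  obtain ⟨x, rfl⟩ : ∃ x, T x = y := T.surjective y
  obtain ⟨v, rfl⟩ := mfderiv_surjective_of_diffeomorph T x v'
  obtain ⟨w, rfl⟩ := mfderiv_surjective_of_diffeomorph T x w'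
  have hsymm (u : TangentSpace J x) : mfderiv J' J T.symm (T x) (mfderiv J J' T x u) = u := by
    have hcomp := mfderiv_comp_apply x (T.symm.contMDiff.mdifferentiable (by simp) (T x))
      (T.contMDiff.mdifferentiable (by simp) x) u
    rw [show T.symm ∘ T = id from funext T.symm_apply_apply, mfderiv_id] at hcomp
    exact hcomp.symm
  have hbase (z : M) (hz : z = x) (a b : E) :
      (g z : E →L[ℝ] E →L[ℝ] ℝ) a b = (g x : E →L[ℝ] E →L[ℝ] ℝ) a b := by rw [hz]
  rw [hsymm, hsymm, hT x v w, one_mul, one_mul]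
  exact hbase _ (T.symm_apply_apply x) v w

variable [IsManifold J ∞ M] [IsManifold J' ∞ M'] [FiniteDimensional ℝ E']

theorem BilinField.IsSmooth.pullback {g : BilinField J M} (hg : g.IsSmooth) {f : M' → M}
    (hf : ContMDiff J' J ∞ f) : (g.pullback J' f).IsSmooth :=
  BilinField.isSmooth_of_apply fun _ _ _ hv hw ↦
    hg.contMDiffAt_apply (contMDiffAt_mfderiv_apply hf hv) (contMDiffAt_mfderiv_apply hf hw)

theorem CovectorField.IsSmooth.pullback {θ : CovectorField J M} (hθ : θ.IsSmooth)
    {f : M' → M} (hf : ContMDiff J' J ∞ f) : (θ.pullback J' f).IsSmooth :=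
  CovectorField.isSmooth_of_apply fun _ _ hv ↦
    hθ.contMDiffAt_apply (contMDiffAt_mfderiv_apply hf hv)

end Pullback

section Transport

variable {𝕜 : Type*} [NontriviallyNormedField 𝕜] {E : Type*} [NormedAddCommGroup E]
  [NormedSpace 𝕜 E] {X : Type*} [TopologicalSpace X] (J : ModelWithCorners 𝕜 E X) (n : ℕ∞ω)
  {M N : Type*} [TopologicalSpace M] [TopologicalSpace N] [ChartedSpace X M] [IsManifold J n M]
  (e : M ≃ₜ N)

theorem isManifold_homeomorph_chartedSpace :
    letI := e.chartedSpace (H := X)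
    IsManifold J n N := by
  let := e.chartedSpace (H := X)
  suffices HasGroupoid N (contDiffGroupoid n J) from { this with }
  refine ⟨?_⟩
  rintro _ _ ⟨q, rfl⟩ ⟨q', rfl⟩
  let L := e.isLocalHomeomorph.localInverseAt
  set p := e.surjective.hasRightInverse.choose q
  set p' := e.surjective.hasRightInverse.choose q'
  let τ := ((L p).trans (chartAt X p)).symm.trans ((L p').trans (chartAt X p'))
  have hτ (y : X) (hy : y ∈ τ.source) :
      L p' (e ((chartAt X p).symm y)) = (chartAt X p).symm y ∧
        y ∈ ((chartAt X p).symm.trans (chartAt X p')).source := by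
    simp only [τ, L, OpenPartialHomeomorph.trans_symm_eq_symm_trans_symm, mfld_simps,
      IsLocalHomeomorph.localInverseAt_symm] at hy
    have hL := e.injective (e.isLocalHomeomorph.apply_localInverseAt_of_mem hy.2.1)
    exact ⟨hL, by simpa [hL] using ⟨hy.1.1, hL ▸ hy.2.2⟩⟩
  refine StructureGroupoid.mem_of_eqOnSource _ (closedUnderRestriction'
    (HasGroupoid.compatible (G := contDiffGroupoid n J) (chart_mem_atlas X p)
      (chart_mem_atlas X p')) τ.open_source) ⟨?_, ?_⟩
  · rw [OpenPartialHomeomorph.restr_source' _ _ τ.open_source]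
    exact (Set.inter_eq_right.2 fun y hy ↦ (hτ y hy).2).symm
  · intro y hy
    change chartAt X p' (L p' ((L p).symm ((chartAt X p).symm y))) = _
    rw [e.isLocalHomeomorph.localInverseAt_symm, (hτ y hy).1]
    rfl

theorem contMDiff_homeomorph_chartedSpace :
    letI := e.chartedSpace (H := X)
    ContMDiff J J n e := by
  let := e.chartedSpace (H := X)
  have := isManifold_homeomorph_chartedSpace J n e
  intro x
  have hg : e.surjective.hasRightInverse.choose (e x) = x :=
    e.injective (e.surjective.hasRightInverse.choose_spec (e x))
  have hchart : chartAt X (e x) (e x) = chartAt X x x := by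
    change chartAt X (e.surjective.hasRightInverse.choose (e x))
      (e.isLocalHomeomorph.localInverseAt (e.surjective.hasRightInverse.choose (e x)) (e x)) = _
    rw [hg, e.isLocalHomeomorph.localInverseAt_apply_self]
  have hsymm (y : X) : (chartAt X (e x)).symm y = e ((chartAt X x).symm y) := by
    change (e.isLocalHomeomorph.localInverseAt (e.surjective.hasRightInverse.choose (e x))).symm
      ((chartAt X (e.surjective.hasRightInverse.choose (e x))).symm y) = _
    rw [hg, e.isLocalHomeomorph.localInverseAt_symm]
  refine ContMDiffAt.congr_of_eventuallyEq (f := (chartAt X (e x)).symm ∘ chartAt X x)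
    (ContMDiffAt.comp x ?_ (contMDiffAt_of_mem_maximalAtlas
      (IsManifold.chart_mem_maximalAtlas x) (mem_chart_source X x))) ?_
  · rw [← hchart]
    exact contMDiffAt_symm_of_mem_maximalAtlas (IsManifold.chart_mem_maximalAtlas (e x))
      (mem_chart_target X (e x))
  · filter_upwards [(chartAt X x).open_source.mem_nhds (mem_chart_source X x)] with y hy
    simp only [Function.comp_apply, hsymm, (chartAt X x).left_inv hy]

theorem contMDiff_symm_homeomorph_chartedSpace :
    letI := e.chartedSpace (H := X)
    ContMDiff J J n e.symm := by
  let := e.chartedSpace (H := X)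
  have := isManifold_homeomorph_chartedSpace J n e
  intro y
  let x := e.surjective.hasRightInverse.choose y
  have hchart (z : N) (hz : z ∈ (chartAt X y).source) :
      e.symm z ∈ (chartAt X x).source ∧ chartAt X y z = chartAt X x (e.symm z) := by
    have hL : e.isLocalHomeomorph.localInverseAt x z = e.symm z :=
      e.injective ((e.isLocalHomeomorph.apply_localInverseAt_of_mem hz.1).trans
        (e.apply_symm_apply z).symm)
    exact ⟨hL ▸ hz.2, congrArg (chartAt X x) hL⟩
  have hy := hchart y (mem_chart_source X y)
  refine ContMDiffAt.congr_of_eventuallyEq (f := (chartAt X x).symm ∘ chartAt X y)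
    (ContMDiffAt.comp y ?_ (contMDiffAt_of_mem_maximalAtlas
      (IsManifold.chart_mem_maximalAtlas y) (mem_chart_source X y))) ?_
  · rw [hy.2]
    exact contMDiffAt_symm_of_mem_maximalAtlas (IsManifold.chart_mem_maximalAtlas x)
      ((chartAt X x).map_source hy.1)
  · filter_upwards [(chartAt X y).open_source.mem_nhds (mem_chart_source X y)] with z hz
    simp only [Function.comp_apply, (hchart z hz).2, (chartAt X x).left_inv (hchart z hz).1]

theorem lieGroup_homeomorph_chartedSpace {G K : Type*} [TopologicalSpace G] [TopologicalSpace K]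
    [ChartedSpace X G] [Group G] [Group K] [LieGroup J n G] (e : G ≃ₜ* K) :
    letI := e.toHomeomorph.chartedSpace (H := X)
    LieGroup J n K := by
  let := e.toHomeomorph.chartedSpace (H := X)
  have he := contMDiff_homeomorph_chartedSpace J n e.toHomeomorph
  have he' := contMDiff_symm_homeomorph_chartedSpace J n e.toHomeomorph
  exact
    { isManifold_homeomorph_chartedSpace J n e.toHomeomorph with
      contMDiff_mul := (he.comp ((he'.comp contMDiff_fst).mul (he'.comp contMDiff_snd))).congr
        fun p ↦ by
          change _ = e (e.symm p.1 * e.symm p.2)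
          simp only [map_mul, ContinuousMulEquiv.apply_symm_apply]
      contMDiff_inv := (he.comp he'.inv).congr fun k ↦ by
        change _ = e (e.symm k)⁻¹
        simp only [map_inv, ContinuousMulEquiv.apply_symm_apply] }

end Transport

section LieGroups

theorem contMDiff_posReal_iff {E : Type*} [NormedAddCommGroup E] [NormedSpace ℝ E]
    {X : Type*} [TopologicalSpace X] {J : ModelWithCorners ℝ E X}
    {M : Type*} [TopologicalSpace M] [ChartedSpace X M] {f : M → PosReal} :
    ContMDiff J 𝓘(ℝ, ℝ) ∞ f ↔ ContMDiff J 𝓘(ℝ, ℝ) ∞ (fun x ↦ (f x : ℝ)) :=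
  (ContMDiff.subtypeVal_comp_iff (⟨Set.Ioi (0 : ℝ), isOpen_Ioi⟩ : TopologicalSpace.Opens ℝ) f).symm

theorem contMDiff_posReal_val : ContMDiff 𝓘(ℝ, ℝ) 𝓘(ℝ, ℝ) ∞ (fun x : PosReal ↦ (x : ℝ)) :=
  contMDiff_posReal_iff.1 contMDiff_id

instance : LieGroup 𝓘(ℝ, ℝ) ∞ PosReal :=
  { (inferInstanceAs (IsManifold 𝓘(ℝ, ℝ) ∞
      (⟨Set.Ioi (0 : ℝ), isOpen_Ioi⟩ : TopologicalSpace.Opens ℝ)) :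
      IsManifold 𝓘(ℝ, ℝ) ∞ PosReal) with
    contMDiff_mul := contMDiff_posReal_iff.2
      ((contMDiff_posReal_val.comp contMDiff_fst).mul (contMDiff_posReal_val.comp contMDiff_snd))
    contMDiff_inv := contMDiff_posReal_iff.2 fun x ↦ (contMDiff_posReal_val x).inv₀ x.2.ne' }

instance : ConnectedSpace PosReal :=
  Subtype.connectedSpace isConnected_Ioi

theorem contMDiff_log_posReal :
    ContMDiff 𝓘(ℝ, ℝ) 𝓘(ℝ, ℝ) ∞ (fun x : PosReal ↦ Real.log x) := fun x ↦
  (contMDiffAt_iff_contDiffAt.2 (Real.contDiffAt_log.2 x.2.ne')).comp x (contMDiff_posReal_val x)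

theorem contMDiff_exp_posReal :
    ContMDiff 𝓘(ℝ, ℝ) 𝓘(ℝ, ℝ) ∞ (fun s : ℝ ↦ (⟨Real.exp s, Real.exp_pos s⟩ : PosReal)) :=
  contMDiff_posReal_iff.2 Real.contDiff_exp.contMDiff

variable {V W : Type*} [NormedAddCommGroup V] [NormedSpace ℝ V] [NormedAddCommGroup W]
  [NormedSpace ℝ W] {G K : Type*} [TopologicalSpace G] [ChartedSpace V G] [TopologicalSpace K]
  [ChartedSpace W K]

/-- The product charts of `G × K`, for the model space `V × W` in place of the type synonym
`ModelProd V W`. This is not a global instance, as `V × W` itself has a different one. -/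
abbrev prodChartedSpaceSelf : ChartedSpace (V × W) (G × K) :=
  inferInstanceAs (ChartedSpace (ModelProd V W) (G × K))

theorem lieGroup_prodChartedSpaceSelf [Group G] [Group K] [LieGroup 𝓘(ℝ, V) ∞ G]
    [LieGroup 𝓘(ℝ, W) ∞ K] :
    letI : ChartedSpace (V × W) (G × K) := prodChartedSpaceSelf
    LieGroup 𝓘(ℝ, V × W) ∞ (G × K) := by
  rw [modelWithCornersSelf_prod]
  exact inferInstanceAs (LieGroup (𝓘(ℝ, V).prod 𝓘(ℝ, W)) ∞ (G × K))

end LieGroups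

/-- The isomorphism of topological groups between the second factor of a product and the kernel of
the projection onto the first one. -/
def sndEquivKerFst (G K : Type*) [Group G] [TopologicalSpace G] [Group K] [TopologicalSpace K] :
    K ≃ₜ* (MonoidHom.fst G K).ker where
  toFun a := ⟨(1, a), rfl⟩
  invFun k := k.1.2
  left_inv _ := rfl
  right_inv k := Subtype.ext (Prod.ext k.2.symm rfl)
  map_mul' _ _ := Subtype.ext (Prod.ext (mul_one 1).symm rfl)
  continuous_toFun := by fun_prop
  continuous_invFun := by fun_prop

section ProductForm

variable {V : Type*} [NormedAddCommGroup V] [NormedSpace ℝ V] [FiniteDimensional ℝ V]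

theorem isInvertible_of_nondegenerate {B : V →L[ℝ] V →L[ℝ] ℝ}
    (hB : ∀ v, (∀ w, B v w = 0) → v = 0) : B.IsInvertible := by
  have hinj : Function.Injective (B : V →ₗ[ℝ] V →L[ℝ] ℝ) := by
    rw [← LinearMap.ker_eq_bot, LinearMap.ker_eq_bot']
    exact fun v hv ↦ hB v fun w ↦ congrArg (fun L : V →L[ℝ] ℝ ↦ L w) hv
  have hdim : Module.finrank ℝ V = Module.finrank ℝ (V →L[ℝ] ℝ) := by
    rw [← (LinearMap.toContinuousLinearMap (𝕜 := ℝ) (E := V) (F' := ℝ)).finrank_eq]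
    exact Subspace.dual_finrank_eq.symm
  exact ⟨(LinearEquiv.ofInjectiveOfFinrankEq _ hinj hdim).toContinuousLinearEquiv, rfl⟩

theorem productForm_nondegenerate_iff {c : ℝ} (hc : c ≠ 0) (α : V →L[ℝ] ℝ)
    {B : V →L[ℝ] V →L[ℝ] ℝ} (hB : ∀ v, (∀ w, B v w = 0) → v = 0) :
    (∀ p, (∀ q, productForm c α B p q = 0) → p = 0) ↔ α (B.inverse α) ≠ 1 := by
  have hBinv := isInvertible_of_nondegenerate hB
  have hsharp (w : V) : B (B.inverse α) w = α w := by rw [hBinv.self_apply_inverse]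
  constructor
  · intro h hα
    have hdegen : ((1, -B.inverse α) : ℝ × V) = 0 := h _ fun q ↦ by
      obtain ⟨b, w⟩ := q
      simp [productForm_apply, hα, hsharp]
    exact one_ne_zero (congrArg Prod.fst hdegen)
  · rintro h ⟨a, v⟩ hav
    have hfst : a + α v = 0 := by
      simpa [productForm_apply, hc] using hav (1, 0)
    have hsnd : v = -a • B.inverse α := by
      refine sub_eq_zero.1 (hB _ fun w ↦ ?_)
      have hw : a * α w + B v w = 0 := by simpa [productForm_apply, hc] using hav (0, w)
      simp only [map_sub, map_smul, sub_apply, smul_apply, hsharp, smul_eq_mul]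
      linarith
    have ha : a * (1 - α (B.inverse α)) = 0 := by
      rw [hsnd, map_smul, smul_eq_mul] at hfst
      linarith
    rw [hsnd, (mul_eq_zero.1 ha).resolve_right (sub_ne_zero.2 h.symm)]
    simp

end ProductForm

namespace QStructure

variable (Q : QStructure.{u}) (t : ℝ)

theorem metric_apply (p : ℝ × Q.N) (v w : TangentSpace (𝓘(ℝ, ℝ).prod 𝓘(ℝ, Q.E)) p) :
    Q.metric t p v w = Real.exp (t * p.1) *
      (v.1 * w.1 + (v.1 * Q.θ p.2 w.2 + w.1 * Q.θ p.2 v.2) + Q.g p.2 v.2 w.2) :=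
  productForm_apply (V := Q.E) ..

theorem nondegenerate_metric_iff :
    (Q.metric t).Nondegenerate ↔ ∀ y : Q.N, Q.g.dualNormSq Q.θ y ≠ 1 := by
  have hfiber (p : ℝ × Q.N) := productForm_nondegenerate_iff (V := Q.E)
    (Real.exp_pos (t * p.1)).ne' (Q.θ p.2) (Q.isPseudoRiemannian.nondegenerate p.2)
  exact ⟨fun h y ↦ (hfiber (0, y)).1 (h (0, y)), fun h p ↦ (hfiber p).2 (h p.2)⟩

theorem isSmooth_metric : (Q.metric t).IsSmooth := by
  refine BilinField.isSmooth_of_apply fun p v w hv hw ↦ ?_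
  have hv₁ := contMDiffAt_snd_of_tangentBundle_vectorSpace (contMDiffAt_fst_vectorField hv)
  have hw₁ := contMDiffAt_snd_of_tangentBundle_vectorSpace (contMDiffAt_fst_vectorField hw)
  have hv₂ := contMDiffAt_snd_vectorField hv
  have hw₂ := contMDiffAt_snd_vectorField hw
  have hg : Q.g.IsSmooth := Q.isPseudoRiemannian.isSmooth
  have hexp : ContMDiffAt (𝓘(ℝ, ℝ).prod 𝓘(ℝ, Q.E)) 𝓘(ℝ, ℝ) ∞
      (fun x : ℝ × Q.N ↦ Real.exp (t * x.1)) p :=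
    (ContDiff.contMDiff (f := fun s : ℝ ↦ Real.exp (t * s)) (by fun_prop)).contMDiffAt.comp p
      contMDiffAt_fst
  simp only [Q.metric_apply]
  exact hexp.mul (((hv₁.mul hw₁).add ((hv₁.mul (Q.smooth_θ.contMDiffAt_apply hw₂)).add
    (hw₁.mul (Q.smooth_θ.contMDiffAt_apply hv₂)))).add (hg.contMDiffAt_apply hv₂ hw₂))

theorem isPseudoRiemannian_metric (h : ∀ y : Q.N, Q.g.dualNormSq Q.θ y ≠ 1) :
    (Q.metric t).IsPseudoRiemannian where
  smooth := Q.isSmooth_metric t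
  symm p v w := by
    rw [Q.metric_apply, Q.metric_apply, Q.isPseudoRiemannian.symm p.2 v.2 w.2]
    ring
  nondegenerate := (Q.nondegenerate_metric_iff t).2 h

/-- The diffeomorphism `(x, y) ↦ (s + x, a • y)` of `ℝ × N`, a homothety of the metrics
`Q.metric t`. -/
def translate (s : ℝ) (a : Q.G) : Diffeomorph (𝓘(ℝ, ℝ).prod 𝓘(ℝ, Q.E))
    (𝓘(ℝ, ℝ).prod 𝓘(ℝ, Q.E)) (ℝ × Q.N) (ℝ × Q.N) ∞ where
  toEquiv := (Equiv.addLeft s).prodCongr (MulAction.toPerm a)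
  contMDiff_toFun := (contMDiff_const.add contMDiff_fst).prodMk
    ((ContMDiffSMul.contMDiff_const_smul (I := 𝓘(ℝ, Q.F)) a).comp contMDiff_snd)
  contMDiff_invFun := (contMDiff_const.add contMDiff_fst).prodMk
    ((ContMDiffSMul.contMDiff_const_smul (I := 𝓘(ℝ, Q.F)) a⁻¹).comp contMDiff_snd)

theorem mfderiv_translate (s : ℝ) (a : Q.G) (p : ℝ × Q.N)
    (v : TangentSpace (𝓘(ℝ, ℝ).prod 𝓘(ℝ, Q.E)) p) :
    mfderiv (𝓘(ℝ, ℝ).prod 𝓘(ℝ, Q.E)) (𝓘(ℝ, ℝ).prod 𝓘(ℝ, Q.E)) (Q.translate s a) p v =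
      (v.1, mfderiv 𝓘(ℝ, Q.E) 𝓘(ℝ, Q.E) (fun y ↦ a • y) p.2 v.2) := by
  have hadd : HasMFDerivAt 𝓘(ℝ, ℝ) 𝓘(ℝ, ℝ) (fun x : ℝ ↦ s + x) p.1
      (ContinuousLinearMap.id ℝ ℝ) :=
    ((hasFDerivAt_id p.1).const_add s).hasMFDerivAt
  have hsmul := ((ContMDiffSMul.contMDiff_const_smul (I := 𝓘(ℝ, Q.F)) (I' := 𝓘(ℝ, Q.E)) (n := ∞)
    (M := Q.N) a).mdifferentiable (by simp) p.2).hasMFDerivAt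
  have hprod : HasMFDerivAt (𝓘(ℝ, ℝ).prod 𝓘(ℝ, Q.E)) (𝓘(ℝ, ℝ).prod 𝓘(ℝ, Q.E))
      (Q.translate s a) p _ := hadd.prodMap hsmul
  rw [hprod.mfderiv, hadd.mfderiv]
  rfl

theorem isHomothetyWith_translate (s : ℝ) (a : Q.G) :
    IsHomothetyWith (Q.metric t) (Q.metric t) (Q.translate s a) (Real.exp (t * s)) := by
  intro p v w
  rw [Q.mfderiv_translate, Q.mfderiv_translate]
  refine (Q.metric_apply t (s + p.1, a • p.2) _ _).trans ?_
  simp only [Q.metric_apply, Q.invariant_θ a p.2 v.2, Q.invariant_θ a p.2 w.2,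
    Q.isometry a p.2 v.2 w.2, mul_add t, Real.exp_add]
  ring

theorem isHomothetyHomogeneous_metric : IsHomothetyHomogeneous (Q.metric t) := by
  intro x y
  obtain ⟨a, ha⟩ := MulAction.exists_smul_eq Q.G x.2 y.2
  refine ⟨Q.translate (y.1 - x.1) a, ⟨Real.exp (t * (y.1 - x.1) / 2), Real.exp_pos _, ?_⟩,
    Prod.ext (sub_add_cancel y.1 x.1) ha⟩
  rw [← Real.exp_nat_mul, Nat.cast_ofNat, mul_div_cancel₀ _ two_ne_zero]
  exact Q.isHomothetyWith_translate t (y.1 - x.1) a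

/-- The action of `ℝ⁺ × G` on `ℝ × N` by translations, in which `r ∈ ℝ⁺` acts with homothety
ratio `r` if `t ≠ 0`. -/
abbrev homothetyAction : MulAction (PosReal × Q.G) (ℝ × Q.N) where
  smul h := Q.translate (2 / t * Real.log h.1) h.2
  one_smul p := by
    change (2 / t * Real.log ((1 : PosReal) : ℝ) + p.1, (1 : Q.G) • p.2) = p
    simp
  mul_smul h k p := by
    change (2 / t * Real.log ((h.1 * k.1 : PosReal) : ℝ) + p.1, (h.2 * k.2) • p.2) =
      (2 / t * Real.log h.1 + (2 / t * Real.log k.1 + p.1), h.2 • k.2 • p.2)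
    rw [Positive.val_mul, Real.log_mul h.1.2.ne' k.1.2.ne', mul_smul, mul_add, add_assoc]

theorem contMDiffSMul_homothetyAction :
    letI := Q.homothetyAction t
    letI : ChartedSpace (ℝ × Q.F) (PosReal × Q.G) := prodChartedSpaceSelf
    ContMDiffSMul 𝓘(ℝ, ℝ × Q.F) (𝓘(ℝ, ℝ).prod 𝓘(ℝ, Q.E)) ∞ (PosReal × Q.G) (ℝ × Q.N) := by
  let := Q.homothetyAction t
  let : ChartedSpace (ℝ × Q.F) (PosReal × Q.G) := prodChartedSpaceSelf
  refine ⟨?_⟩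
  rw [modelWithCornersSelf_prod]
  exact ((contMDiff_const.mul
    (contMDiff_log_posReal.comp (contMDiff_fst.comp contMDiff_fst))).add
    (contMDiff_fst.comp contMDiff_snd)).prodMk
    ((contMDiff_snd.comp contMDiff_fst).smul (I := 𝓘(ℝ, Q.F)) (contMDiff_snd.comp contMDiff_snd))

theorem isPretransitive_homothetyAction {t : ℝ} (ht : t ≠ 0) :
    letI := Q.homothetyAction t
    MulAction.IsPretransitive (PosReal × Q.G) (ℝ × Q.N) := by
  let := Q.homothetyAction t
  refine ⟨fun x y ↦ ?_⟩
  obtain ⟨a, ha⟩ := MulAction.exists_smul_eq Q.G x.2 y.2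
  refine ⟨(⟨Real.exp (t / 2 * (y.1 - x.1)), Real.exp_pos _⟩, a), Prod.ext ?_ ha⟩
  change 2 / t * Real.log (Real.exp (t / 2 * (y.1 - x.1))) + x.1 = y.1
  rw [Real.log_exp]
  field_simp
  ring

theorem faithfulSMul_homothetyAction {t : ℝ} (ht : t ≠ 0) :
    letI := Q.homothetyAction t
    FaithfulSMul (PosReal × Q.G) (ℝ × Q.N) := by
  let := Q.homothetyAction t
  refine ⟨fun {h k} hhk ↦ ?_⟩
  obtain ⟨y₀⟩ := (inferInstance : Nonempty Q.N)
  have hlog : 2 / t * Real.log h.1 + 0 = 2 / t * Real.log k.1 + 0 :=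
    congrArg Prod.fst (hhk (0, y₀))
  refine Prod.ext (Subtype.ext ?_)
    (FaithfulSMul.eq_of_smul_eq_smul fun y : Q.N ↦ congrArg Prod.snd (hhk (0, y)))
  exact Real.log_injOn_pos h.1.2 k.1.2
    (mul_left_cancel₀ (div_ne_zero two_ne_zero ht) (add_right_cancel hlog))

/-- The group `ℝ⁺ × G` of homotheties of `ℝ × N`; its homothety character is the projection. -/
abbrev homothetyGroup {t : ℝ} (ht : t ≠ 0) : HomothetyGroup (Q.metric t) :=
  letI := Q.homothetyAction t
  { F := ℝ × Q.F
    H := PosReal × Q.G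
    chartedSpace := prodChartedSpaceSelf
    lieGroup := lieGroup_prodChartedSpaceSelf
    contMDiffSMul := Q.contMDiffSMul_homothetyAction t
    isPretransitive := Q.isPretransitive_homothetyAction ht
    faithfulSMul := Q.faithfulSMul_homothetyAction ht
    char := MonoidHom.fst PosReal Q.G
    contMDiff_char := by
      rw [modelWithCornersSelf_prod]
      exact contMDiff_fst
    homothety := fun h ↦ by
      have hratio : Real.exp (t * (2 / t * Real.log h.1)) = (h.1 : ℝ) ^ 2 := by
        rw [← mul_assoc, mul_div_cancel₀ _ ht, ← Nat.cast_ofNat, Real.exp_nat_mul,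
          Real.exp_log h.1.2]
      rw [MonoidHom.coe_fst, ← hratio]
      exact Q.isHomothetyWith_translate t (2 / t * Real.log h.1) h.2 }

theorem char_homothetyGroup_ne_one {t : ℝ} (ht : t ≠ 0) : (Q.homothetyGroup ht).char ≠ 1 := by
  intro h
  have htwo : (⟨2, two_pos⟩ : PosReal) = 1 :=
    congrArg (fun f : PosReal × Q.G →* PosReal ↦ f (⟨2, two_pos⟩, 1)) h
  exact absurd (congrArg Subtype.val htwo) (by norm_num)

/-- The splitting of `ℝ⁺ × G` given by the two projections, the smooth structure of the kernel
`{1} × G` of the homothety character being that of `G`. -/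
def homothetySplitting {t : ℝ} (ht : t ≠ 0) : (Q.homothetyGroup ht).Splitting :=
  let e := sndEquivKerFst PosReal Q.G
  letI : ChartedSpace Q.F (MonoidHom.fst PosReal Q.G).ker := e.toHomeomorph.chartedSpace
  letI : ChartedSpace (ℝ × Q.F) (PosReal × Q.G) := prodChartedSpaceSelf
  have hiso : ContMDiff 𝓘(ℝ, ℝ × Q.F) (𝓘(ℝ, ℝ).prod 𝓘(ℝ, Q.F)) ∞
      (fun p : PosReal × Q.G ↦ (p.1, e p.2)) := by
    rw [modelWithCornersSelf_prod]
    exact contMDiff_fst.prodMk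
      ((contMDiff_homeomorph_chartedSpace 𝓘(ℝ, Q.F) ∞ e.toHomeomorph).comp contMDiff_snd)
  have hsymm : ContMDiff (𝓘(ℝ, ℝ).prod 𝓘(ℝ, Q.F)) 𝓘(ℝ, ℝ × Q.F) ∞
      (fun p : PosReal × (MonoidHom.fst PosReal Q.G).ker ↦ (p.1, e.symm p.2)) := by
    rw [modelWithCornersSelf_prod]
    exact contMDiff_fst.prodMk
      ((contMDiff_symm_homeomorph_chartedSpace 𝓘(ℝ, Q.F) ∞ e.toHomeomorph).comp contMDiff_snd)
  { K := Q.F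
    chartedSpace := e.toHomeomorph.chartedSpace
    lieGroup := lieGroup_homeomorph_chartedSpace 𝓘(ℝ, Q.F) ∞ e
    iso := (MulEquiv.refl PosReal).prodCongr e.toMulEquiv
    contMDiff_iso := hiso
    contMDiff_iso_symm := hsymm
    fst_iso := fun _ ↦ rfl }

end QStructure

section SliceCharts

open Manifold Topology

variable {E V F : Type*} [NormedAddCommGroup E] [NormedSpace ℝ E]
  [NormedAddCommGroup V] [NormedSpace ℝ V] [NormedAddCommGroup F] [NormedSpace ℝ F]
  {M : Type*} [TopologicalSpace M] [ChartedSpace E M] {n : ℕ∞ω} {S : Set M}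

variable (E V F n S) in
/-- A `C^n` slice chart of a subset `S` of `M`: a chart of `M` in which `S` becomes the subspace
`V × {0}` of the model space `V × F ≃ E`. -/
structure SliceChart where
  chart : OpenPartialHomeomorph M E
  mem_maximalAtlas : chart ∈ IsManifold.maximalAtlas 𝓘(ℝ, E) n M
  equiv : (V × F) ≃L[ℝ] E
  mem_iff : ∀ x ∈ chart.source, x ∈ S ↔ (equiv.symm (chart x)).2 = 0

namespace SliceChart

variable (c : SliceChart E V F n S)

theorem equiv_fst {x : M} (hx : x ∈ c.chart.source) (hxS : x ∈ S) :
    c.equiv ((c.equiv.symm (c.chart x)).1, 0) = c.chart x := by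
  rw [← (c.mem_iff x hx).1 hxS, Prod.mk.eta, c.equiv.apply_symm_apply]

theorem chart_symm_mem {v : V} (hv : c.equiv (v, 0) ∈ c.chart.target) :
    c.chart.symm (c.equiv (v, 0)) ∈ S := by
  rw [c.mem_iff _ (c.chart.map_target hv), c.chart.right_inv hv, c.equiv.symm_apply_apply]

open Classical in
/-- The chart of `S` induced by a slice chart. The point `p` is a dummy value of the inverse. -/
def restrict (p : S) : OpenPartialHomeomorph S V where
  toFun x := (c.equiv.symm (c.chart x)).1
  invFun v := if h : c.chart.symm (c.equiv (v, 0)) ∈ S then ⟨_, h⟩ else p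
  source := Subtype.val ⁻¹' c.chart.source
  target := (fun v ↦ c.equiv (v, 0)) ⁻¹' c.chart.target
  map_source' x hx := by
    rw [Set.mem_preimage, c.equiv_fst hx x.2]
    exact c.chart.map_source hx
  map_target' v hv := by
    rw [Set.mem_preimage, dif_pos (c.chart_symm_mem hv)]
    exact c.chart.map_target hv
  left_inv' x hx := by
    have h : c.chart.symm (c.equiv ((c.equiv.symm (c.chart x)).1, 0)) = x := by
      rw [c.equiv_fst hx x.2, c.chart.left_inv hx]
    rw [dif_pos (by rw [h]; exact x.2)]
    exact Subtype.ext h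
  right_inv' v hv := by
    rw [dif_pos (c.chart_symm_mem hv), c.chart.right_inv hv, c.equiv.symm_apply_apply]
  open_source := c.chart.open_source.preimage continuous_subtype_val
  open_target := c.chart.open_target.preimage (by fun_prop)
  continuousOn_toFun := (continuous_fst.comp c.equiv.symm.continuous).comp_continuousOn
    (c.chart.continuousOn.comp continuous_subtype_val.continuousOn fun _ h ↦ h)
  continuousOn_invFun := by
    refine IsInducing.subtypeVal.continuousOn_iff.2 ?_
    refine (c.chart.continuousOn_symm.comp (f := fun v ↦ c.equiv (v, 0)) (by fun_prop)
      fun _ h ↦ h).congr fun v hv ↦ ?_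
    exact congrArg Subtype.val (dif_pos (c.chart_symm_mem hv))

theorem coe_restrict_symm (p : S) {v : V} (hv : v ∈ (c.restrict p).target) :
    ((c.restrict p).symm v : M) = c.chart.symm (c.equiv (v, 0)) :=
  congrArg Subtype.val (dif_pos (c.chart_symm_mem hv))

theorem contMDiffAt_coe_restrict_symm (p : S) {v : V} (hv : v ∈ (c.restrict p).target) :
    ContMDiffAt 𝓘(ℝ, V) 𝓘(ℝ, E) n (fun v ↦ ((c.restrict p).symm v : M)) v := by
  have hincl : ContMDiffAt 𝓘(ℝ, V) 𝓘(ℝ, E) n (fun v : V ↦ c.equiv (v, 0)) v :=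
    contMDiffAt_iff_contDiffAt.2 (by fun_prop)
  refine ((contMDiffAt_symm_of_mem_maximalAtlas c.mem_maximalAtlas hv).comp v
    hincl).congr_of_eventuallyEq ?_
  filter_upwards [(c.restrict p).open_target.mem_nhds hv] with w hw
  exact c.coe_restrict_symm p hw

theorem contMDiffAt_equiv_symm_chart_fst {x : M} (hx : x ∈ c.chart.source) :
    ContMDiffAt 𝓘(ℝ, E) 𝓘(ℝ, V) n (fun x ↦ (c.equiv.symm (c.chart x)).1) x :=
  ContMDiffAt.comp (g := fun y ↦ (c.equiv.symm y).1) x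
    (contMDiffAt_iff_contDiffAt.2 (by fun_prop))
    (contMDiffAt_of_mem_maximalAtlas c.mem_maximalAtlas hx)

/-- The charted space structure on `S` given by slice charts around its points. -/
abbrev chartedSpace (c : S → SliceChart E V F n S) (hc : ∀ p : S, (p : M) ∈ (c p).chart.source) :
    ChartedSpace V S where
  atlas := Set.range fun p ↦ (c p).restrict p
  chartAt p := (c p).restrict p
  mem_chart_source := hc
  chart_mem_atlas p := ⟨p, rfl⟩

variable (c : S → SliceChart E V F n S) (hc : ∀ p : S, (p : M) ∈ (c p).chart.source)

theorem isManifold_chartedSpace :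
    letI := chartedSpace c hc
    IsManifold 𝓘(ℝ, V) n S := by
  let := chartedSpace c hc
  refine isManifold_of_contDiffOn _ _ _ ?_
  rintro _ _ ⟨p, rfl⟩ ⟨q, rfl⟩ v hv
  simp only [modelWithCornersSelf_coe, modelWithCornersSelf_coe_symm, Set.preimage_id,
    Set.range_id, Set.inter_univ, OpenPartialHomeomorph.trans_source,
    OpenPartialHomeomorph.symm_source] at hv
  refine (contMDiffAt_iff_contDiffAt.1 ?_).contDiffWithinAt
  exact ContMDiffAt.comp (f := fun v ↦ (((c p).restrict p).symm v : M)) v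
    ((c q).contMDiffAt_equiv_symm_chart_fst hv.2) ((c p).contMDiffAt_coe_restrict_symm p hv.1)

theorem isSmoothEmbedding_chartedSpace :
    letI := chartedSpace c hc
    IsSmoothEmbedding 𝓘(ℝ, V) 𝓘(ℝ, E) n (Subtype.val : S → M) := by
  let := chartedSpace c hc
  have := isManifold_chartedSpace c hc
  have himm : IsImmersionOfComplement F 𝓘(ℝ, V) 𝓘(ℝ, E) n (Subtype.val : S → M) := fun p ↦
    .mk_of_charts (c p).equiv ((c p).restrict p) (c p).chart (hc p) (hc p)
      (IsManifold.chart_mem_maximalAtlas p) (c p).mem_maximalAtlas subset_rfl fun v hv ↦ by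
        have hv' : v ∈ ((c p).restrict p).target := by simpa using hv
        change (c p).chart (((c p).restrict p).symm v) = (c p).equiv (v, 0)
        rw [(c p).coe_restrict_symm p hv', (c p).chart.right_inv hv']
  exact ⟨himm.isImmersion, .subtypeVal⟩

end SliceChart

end SliceCharts

section RegularLevelSets

open Manifold Topology

variable {E V F : Type*} [NormedAddCommGroup E] [NormedSpace ℝ E]
  [NormedAddCommGroup V] [NormedSpace ℝ V] [NormedAddCommGroup F] [NormedSpace ℝ F]
  {n : ℕ∞ω}

theorem exists_openPartialHomeomorph_contDiffOn [CompleteSpace E] (hn : n ≠ 0) {f : E → F}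
    {s : Set E} (hs : IsOpen s) (hf : ContDiffOn ℝ n f s) {x : E} (hx : x ∈ s)
    {e : E ≃L[ℝ] F} (he : HasFDerivAt f (e : E →L[ℝ] F) x) :
    ∃ φ : OpenPartialHomeomorph E F, x ∈ φ.source ∧ φ.source ⊆ s ∧ (φ : E → F) = f ∧
      ContDiffOn ℝ n φ.symm φ.target := by
  have hfAt (y : E) (hy : y ∈ s) : ContDiffAt ℝ n f y := hf.contDiffAt (hs.mem_nhds hy)
  let W : Set E := s ∩ fderiv ℝ f ⁻¹' Set.range ((↑) : (E ≃L[ℝ] F) → E →L[ℝ] F)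
  have hW : IsOpen W := (hf.continuousOn_fderiv_of_isOpen hs
    (ENat.one_le_iff_ne_zero_withTop.2 hn)).isOpen_inter_preimage hs ContinuousLinearEquiv.isOpen
  let φ := ((hfAt x hx).toOpenPartialHomeomorph f he hn).restrOpen W hW
  refine ⟨φ, ⟨(hfAt x hx).mem_toOpenPartialHomeomorph_source he hn, hx, e, he.fderiv.symm⟩,
    fun y hy ↦ hy.2.1, rfl, fun z hz ↦ ContDiffAt.contDiffWithinAt ?_⟩
  obtain ⟨hy, e', he'⟩ := (φ.map_target hz).2
  refine φ.contDiffAt_symm (f₀' := e') hz ?_ (hfAt _ hy)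
  rw [he']
  exact ((hfAt _ hy).differentiableAt hn).hasFDerivAt

variable [FiniteDimensional ℝ E] [FiniteDimensional ℝ V] [FiniteDimensional ℝ F]

theorem exists_continuousLinearEquiv_snd_eq
    (hdim : Module.finrank ℝ V + Module.finrank ℝ F = Module.finrank ℝ E) {L : E →L[ℝ] F}
    (hL : Function.Surjective L) : ∃ e : E ≃L[ℝ] V × F, ∀ x, (e x).2 = L x := by
  obtain ⟨P, hP⟩ := L.ker_closedComplemented_of_finiteDimensional_range
  have hker : Module.finrank ℝ (LinearMap.ker (L : E →ₗ[ℝ] F)) = Module.finrank ℝ V := by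
    have hrank := (L : E →ₗ[ℝ] F).finrank_range_add_finrank_ker
    rw [LinearMap.range_eq_top.2 hL, finrank_top] at hrank
    omega
  let k : LinearMap.ker (L : E →ₗ[ℝ] F) ≃L[ℝ] V := .ofFinrankEq hker
  let A : E →L[ℝ] V × F := (k ∘L P).prod L
  have hinj : Function.Injective (A : E →ₗ[ℝ] V × F) := by
    rw [← LinearMap.ker_eq_bot, LinearMap.ker_eq_bot']
    intro x hx
    have hLx : L x = 0 := congrArg Prod.snd hx
    have hPx : P x = 0 := k.map_eq_zero_iff.1 (congrArg Prod.fst hx)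
    exact congrArg Subtype.val ((hP ⟨x, hLx⟩).symm.trans hPx)
  exact ⟨(LinearEquiv.ofInjectiveOfFinrankEq _ hinj
    (by rw [Module.finrank_prod, hdim])).toContinuousLinearEquiv, fun _ ↦ rfl⟩

variable {M : Type*} [TopologicalSpace M] [ChartedSpace E M] [IsManifold 𝓘(ℝ, E) n M]

theorem exists_sliceChart_levelSet
    (hdim : Module.finrank ℝ V + Module.finrank ℝ F = Module.finrank ℝ E) (hn : n ≠ 0)
    {f : M → F} (hf : ContMDiff 𝓘(ℝ, E) 𝓘(ℝ, F) n f) (a : F) (p : M)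
    (hp : Function.Surjective (mfderiv 𝓘(ℝ, E) 𝓘(ℝ, F) f p)) :
    ∃ c : SliceChart E V F n {x | f x = a}, p ∈ c.chart.source := by
  let φ := chartAt E p
  have hφ : φ ∈ IsManifold.maximalAtlas 𝓘(ℝ, E) n M := IsManifold.chart_mem_maximalAtlas p
  have hfφ : ContDiffOn ℝ n (f ∘ φ.symm) φ.target := contMDiffOn_iff_contDiffOn.1
    (hf.comp_contMDiffOn (contMDiffOn_symm_of_mem_maximalAtlas hφ))
  let L : E →L[ℝ] F := mfderiv 𝓘(ℝ, E) 𝓘(ℝ, F) f p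
  have hL : HasFDerivAt (f ∘ φ.symm) L (φ p) := by
    have h : HasFDerivWithinAt (f ∘ φ.symm) L (Set.range id) (φ p) :=
      (hf.mdifferentiable hn p).hasMFDerivAt.2
    rwa [Set.range_id, hasFDerivWithinAt_univ] at h
  obtain ⟨e, he⟩ := exists_continuousLinearEquiv_snd_eq (L := L) hdim hp
  -- `e ∘ Ψ` replaces the `F`-component of `e` by `f - a`, so that the derivative of `Ψ` is `id`.
  let Ψ : E → E := fun y ↦ e.symm ((e y).1, f (φ.symm y) - a)
  have hΨ : ContDiffOn ℝ n Ψ φ.target := e.symm.contDiff.comp_contDiffOn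
    ((contDiff_fst.comp e.contDiff).contDiffOn.prodMk (hfφ.sub contDiffOn_const))
  have hΨ' : HasFDerivAt Ψ (ContinuousLinearEquiv.refl ℝ E : E →L[ℝ] E) (φ p) := by
    have hprod := e.symm.hasFDerivAt.comp (φ p)
      ((hasFDerivAt_fst.comp (φ p) e.hasFDerivAt).prodMk (hL.sub_const a))
    refine hprod.congr_fderiv (ContinuousLinearMap.ext fun v ↦ ?_)
    have hv : ((e v).1, L v) = e v := Prod.ext rfl (he v).symm
    exact (congrArg e.symm hv).trans (e.symm_apply_apply v)
  obtain ⟨χ, hpχ, _, hχΨ, hχsymm⟩ := exists_openPartialHomeomorph_contDiffOn hn φ.open_target hΨ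
    (mem_chart_target E p) hΨ'
  refine ⟨⟨φ.trans χ, OpenPartialHomeomorph.mem_maximalAtlas_of_contMDiffOn _ ?_ ?_, e.symm,
    fun x hx ↦ ?_⟩, ?_⟩
  · rw [OpenPartialHomeomorph.coe_trans, hχΨ]
    exact hΨ.contMDiffOn.comp ((contMDiffOn_of_mem_maximalAtlas hφ).mono (by simp))
      fun x hx ↦ φ.map_source hx.1
  · rw [OpenPartialHomeomorph.coe_trans_symm]
    exact (contMDiffOn_symm_of_mem_maximalAtlas hφ).comp (hχsymm.contMDiffOn.mono (by simp))
      fun z hz ↦ hz.2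
  · have : φ.symm (φ x) = x := φ.left_inv hx.1
    simp [hχΨ, Ψ, this, sub_eq_zero]
  · exact ⟨mem_chart_source E p, hpχ⟩

theorem exists_isSmoothEmbedding_levelSet
    (hdim : Module.finrank ℝ V + Module.finrank ℝ F = Module.finrank ℝ E) (hn : n ≠ 0)
    {f : M → F} (hf : ContMDiff 𝓘(ℝ, E) 𝓘(ℝ, F) n f) (a : F)
    (hreg : ∀ p, f p = a → Function.Surjective (mfderiv 𝓘(ℝ, E) 𝓘(ℝ, F) f p)) :
    ∃ _ : ChartedSpace V {x | f x = a}, IsManifold 𝓘(ℝ, V) n {x | f x = a} ∧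
      IsSmoothEmbedding 𝓘(ℝ, V) 𝓘(ℝ, E) n (Subtype.val : {x | f x = a} → M) := by
  choose c hc using fun p : {x | f x = a} ↦
    exists_sliceChart_levelSet (V := V) hdim hn hf a p (hreg p p.2)
  exact ⟨SliceChart.chartedSpace c hc, SliceChart.isManifold_chartedSpace c hc,
    SliceChart.isSmoothEmbedding_chartedSpace c hc⟩

end RegularLevelSets

section SmoothEmbeddings

open Manifold

variable {𝕜 : Type*} [NontriviallyNormedField 𝕜]
  {E E' E'' : Type*} [NormedAddCommGroup E] [NormedSpace 𝕜 E] [NormedAddCommGroup E']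
  [NormedSpace 𝕜 E'] [NormedAddCommGroup E''] [NormedSpace 𝕜 E'']
  {X X' X'' : Type*} [TopologicalSpace X] [TopologicalSpace X'] [TopologicalSpace X'']
  {J : ModelWithCorners 𝕜 E X} {J' : ModelWithCorners 𝕜 E' X'} {J'' : ModelWithCorners 𝕜 E'' X''}
  {M M' M'' : Type*} [TopologicalSpace M] [ChartedSpace X M] [TopologicalSpace M']
  [ChartedSpace X' M'] [TopologicalSpace M''] [ChartedSpace X'' M''] {n : ℕ∞ω}

theorem contMDiff_of_comp_isSmoothEmbedding [IsManifold J n M] [IsManifold J' n M']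
    [IsManifold J'' n M''] {φ : M' → M''} (hφ : IsSmoothEmbedding J' J'' n φ) {f : M → M'}
    (h : ContMDiff J J'' n (φ ∘ f)) : ContMDiff J J' n f :=
  (ContMDiff.iff_comp_isImmersion hφ.isImmersion).2
    ⟨hφ.isEmbedding.continuous_iff.2 h.continuous, h⟩

end SmoothEmbeddings

namespace HomothetyGroup.Splitting

attribute [instance] normedAddCommGroup normedSpace finiteDimensional chartedSpace lieGroup

section Generator

variable {E : Type*} [NormedAddCommGroup E] [NormedSpace ℝ E]
  {X : Type*} [TopologicalSpace X] {J : ModelWithCorners ℝ E X}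
  {M : Type u} [TopologicalSpace M] [ChartedSpace X M]
  {g : BilinField J M} {𝓗 : HomothetyGroup g} (S : 𝓗.Splitting)

theorem flow_add (s t : ℝ) : S.flow (s + t) = S.flow s * S.flow t := by
  rw [flow, flow, flow, ← map_mul]
  exact congrArg S.iso.symm (Prod.ext (Subtype.ext (Real.exp_add s t)) (one_mul 1).symm)

theorem flow_zero : S.flow 0 = 1 := by
  rw [flow, ← map_one S.iso.symm]
  exact congrArg S.iso.symm (Prod.ext (Subtype.ext Real.exp_zero) rfl)

theorem char_flow (s : ℝ) : (𝓗.char (S.flow s) : ℝ) = Real.exp s := by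
  rw [← S.fst_iso, flow, S.iso.apply_symm_apply]

theorem flow_mul_comm (s : ℝ) (h : 𝓗.H) : S.flow s * h = h * S.flow s := by
  apply S.iso.injective
  rw [map_mul, map_mul, flow, S.iso.apply_symm_apply]
  exact Prod.ext (mul_comm _ _) ((one_mul _).trans (mul_one _).symm)

theorem flow_smul_comm (s : ℝ) (h : 𝓗.H) (x : M) : S.flow s • h • x = h • S.flow s • x := by
  rw [smul_smul, S.flow_mul_comm, ← smul_smul]

theorem contMDiff_flow : ContMDiff 𝓘(ℝ, ℝ) 𝓘(ℝ, 𝓗.F) ∞ S.flow :=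
  S.contMDiff_iso_symm.comp (contMDiff_exp_posReal.prodMk contMDiff_const)

theorem contMDiff_flow_smul :
    ContMDiff (𝓘(ℝ, ℝ).prod J) J ∞ (fun p : ℝ × M ↦ S.flow p.1 • p.2) :=
  (S.contMDiff_flow.comp contMDiff_fst).smul (I := 𝓘(ℝ, 𝓗.F)) contMDiff_snd

theorem contMDiff_orbit (x : M) : ContMDiff 𝓘(ℝ, ℝ) J ∞ (fun s : ℝ ↦ S.flow s • x) :=
  S.contMDiff_flow_smul.comp (contMDiff_id.prodMk contMDiff_const)

theorem mfderiv_smul_generator (h : 𝓗.H) (x : M) :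
    mfderiv J J (fun y : M ↦ h • y) x (S.generator x) = S.generator (h • x) := by
  have hsmul : ContMDiff J J ∞ (fun y : M ↦ h • y) :=
    ContMDiffSMul.contMDiff_const_smul (I := 𝓘(ℝ, 𝓗.F)) h
  have hcomp := mfderiv_comp_apply_of_eq (f := fun s : ℝ ↦ S.flow s • x)
    (g := fun y : M ↦ h • y) (y := x) (0 : ℝ) (hsmul.mdifferentiable (by simp) x)
    ((S.contMDiff_orbit x).mdifferentiable (by simp) 0) (by rw [S.flow_zero, one_smul]) (1 : ℝ)
  have horbit : (fun y : M ↦ h • y) ∘ (fun s : ℝ ↦ S.flow s • x) = fun s ↦ S.flow s • h • x :=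
    funext fun s ↦ (S.flow_smul_comm s h x).symm
  rw [horbit] at hcomp
  exact hcomp.symm

theorem mfderiv_orbit (s a : ℝ) (x : M) :
    mfderiv 𝓘(ℝ, ℝ) J (fun s : ℝ ↦ S.flow s • x) s a =
      mfderiv J J (fun y : M ↦ S.flow s • y) x (a • S.generator x) := by
  have hsub : HasMFDerivAt 𝓘(ℝ, ℝ) 𝓘(ℝ, ℝ) (fun r : ℝ ↦ r - s) s (ContinuousLinearMap.id ℝ ℝ) :=
    ((hasFDerivAt_id s).sub_const s).hasMFDerivAt
  have hcomp := mfderiv_comp_apply_of_eq (f := fun r : ℝ ↦ r - s)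
    (g := fun r : ℝ ↦ S.flow r • S.flow s • x) (y := 0) s
    ((S.contMDiff_orbit (S.flow s • x)).mdifferentiable (by simp) 0)
    hsub.mdifferentiableAt (sub_self s) a
  have horbit : (fun r : ℝ ↦ S.flow r • S.flow s • x) ∘ (fun r : ℝ ↦ r - s) =
      fun r ↦ S.flow r • x := by
    funext r
    rw [Function.comp_apply, smul_smul, ← S.flow_add, sub_add_cancel]
  have hlin (L : ℝ →L[ℝ] E) : L a = a • L 1 := by rw [← map_smul, smul_eq_mul, mul_one]
  rw [horbit, hsub.mfderiv] at hcomp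
  rw [map_smul, S.mfderiv_smul_generator]
  exact hcomp.trans (hlin _)

theorem mfderiv_flow_smul (s a : ℝ) (x : M) (v : TangentSpace J x) :
    mfderiv (𝓘(ℝ, ℝ).prod J) J (fun p : ℝ × M ↦ S.flow p.1 • p.2) (s, x) (a, v) =
      mfderiv J J (fun y : M ↦ S.flow s • y) x (a • S.generator x + v) := by
  rw [map_add, ← S.mfderiv_orbit]
  exact mfderiv_prod_eq_add_apply (S.contMDiff_flow_smul.mdifferentiable (by simp) (s, x))

/-- The squared length `g(ξ, ξ)` of the generator of a splitting. -/
def lengthSq (x : M) : ℝ := g x (S.generator x) (S.generator x)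

theorem lengthSq_smul (h : 𝓗.H) (x : M) :
    S.lengthSq (h • x) = (𝓗.char h : ℝ) ^ 2 * S.lengthSq x := by
  rw [lengthSq, ← S.mfderiv_smul_generator]
  exact 𝓗.homothety h x _ _

theorem lengthSq_flow_smul (s : ℝ) (x : M) :
    S.lengthSq (S.flow s • x) = Real.exp s ^ 2 * S.lengthSq x := by
  rw [S.lengthSq_smul, S.char_flow]

/-- The `1`-form `ξ♭ = g(ξ, ·)` dual to the generator of a splitting. -/
def generatorForm : CovectorField J M := fun x ↦ g x (S.generator x)

variable [IsManifold J ∞ M]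

theorem contMDiff_generator :
    ContMDiff J J.tangent ∞ (fun x ↦ (⟨x, S.generator x⟩ : TangentBundle J M)) := by
  -- `ξ` is the image under `d((s, x) ↦ Φ_s x)` of the vector field `(d/ds, 0)` along `s = 0`.
  let σ : M → TangentBundle (𝓘(ℝ, ℝ).prod J) (ℝ × M) := fun x ↦
    (equivTangentBundleProd 𝓘(ℝ, ℝ) ℝ J M).symm
      ((⟨0, (1 : ℝ)⟩ : TangentBundle 𝓘(ℝ, ℝ) ℝ), zeroSection E (TangentSpace J) x)
  have hσ : ContMDiff J (𝓘(ℝ, ℝ).prod J).tangent ∞ σ :=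
    contMDiff_equivTangentBundleProd_symm.comp
      (contMDiff_const.prodMk (contMDiff_zeroSection ℝ (TangentSpace J : M → Type _)))
  refine ((S.contMDiff_flow_smul.contMDiff_tangentMap (m := ∞) (by simp)).comp hσ).congr
    fun x ↦ ?_
  have himage : tangentMap (𝓘(ℝ, ℝ).prod J) J (fun p : ℝ × M ↦ S.flow p.1 • p.2) (σ x) =
      ⟨S.flow 0 • x, S.generator (S.flow 0 • x)⟩ := by
    refine TotalSpace.ext rfl (heq_of_eq ?_)
    refine (S.mfderiv_flow_smul 0 1 x 0).trans ?_
    rw [← S.mfderiv_smul_generator, one_smul, add_zero]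
  rw [Function.comp_apply, himage, S.flow_zero, one_smul]

variable (hg : g.IsSmooth)

include hg

theorem isSmooth_generatorForm [FiniteDimensional ℝ E] : S.generatorForm.IsSmooth :=
  CovectorField.isSmooth_of_apply fun x _ hv ↦
    hg.contMDiffAt_apply (S.contMDiff_generator x) hv

theorem contMDiff_lengthSq : ContMDiff J 𝓘(ℝ, ℝ) ∞ S.lengthSq := fun x ↦
  hg.contMDiffAt_apply (S.contMDiff_generator x) (S.contMDiff_generator x)

theorem mfderiv_lengthSq_generator (x : M) :
    mfderiv J 𝓘(ℝ, ℝ) S.lengthSq x (S.generator x) = 2 * S.lengthSq x := by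
  have hcomp := mfderiv_comp_apply_of_eq (f := fun s : ℝ ↦ S.flow s • x) (g := S.lengthSq)
    (y := x) (0 : ℝ) ((S.contMDiff_lengthSq hg).mdifferentiable (by simp) x)
    ((S.contMDiff_orbit x).mdifferentiable (by simp) 0) (by rw [S.flow_zero, one_smul]) (1 : ℝ)
  have horbit : S.lengthSq ∘ (fun s : ℝ ↦ S.flow s • x) = fun s ↦ Real.exp s ^ 2 * S.lengthSq x :=
    funext fun s ↦ S.lengthSq_flow_smul s x
  have hexp : HasDerivAt (fun s ↦ Real.exp s ^ 2 * S.lengthSq x) (2 * S.lengthSq x) 0 := by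
    simpa using ((Real.hasDerivAt_exp 0).pow 2).mul_const (S.lengthSq x)
  rw [horbit, hexp.hasFDerivAt.hasMFDerivAt.mfderiv] at hcomp
  exact hcomp.symm.trans (one_smul ℝ (2 * S.lengthSq x))

theorem mfderiv_lengthSq_surjective {x : M} (hx : S.lengthSq x ≠ 0) :
    Function.Surjective (mfderiv J 𝓘(ℝ, ℝ) S.lengthSq x) := by
  let L : E →L[ℝ] ℝ := mfderiv J 𝓘(ℝ, ℝ) S.lengthSq x
  have hL : L ≠ 0 := fun h ↦ mul_ne_zero two_ne_zero hx
    ((S.mfderiv_lengthSq_generator hg x).symm.trans (congrArg (· (S.generator x)) h))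
  exact LinearMap.surjective (f := (L : E →ₗ[ℝ] ℝ)) fun h ↦ hL (ContinuousLinearMap.coe_injective h)

end Generator

section UnitLevel

variable {E : Type*} [NormedAddCommGroup E] [NormedSpace ℝ E]
  {X : Type*} [TopologicalSpace X] {J : ModelWithCorners ℝ E X}
  {M : Type u} [TopologicalSpace M] [ChartedSpace X M]
  {g : BilinField J M} {𝓗 : HomothetyGroup g} (S : 𝓗.Splitting)

/-- The embedding of the kernel of the homothety character in the group given by a splitting. It
need not be the inclusion, as `S.iso` may restrict to a non-trivial automorphism of the kernel. -/
def kerHom : 𝓗.char.ker →* 𝓗.H :=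
  S.iso.symm.toMonoidHom.comp (MonoidHom.inr PosReal 𝓗.char.ker)

theorem contMDiff_kerHom : ContMDiff 𝓘(ℝ, S.K) 𝓘(ℝ, 𝓗.F) ∞ S.kerHom :=
  S.contMDiff_iso_symm.comp (contMDiff_const.prodMk contMDiff_id)

theorem char_kerHom (k : 𝓗.char.ker) : 𝓗.char (S.kerHom k) = 1 := by
  rw [← S.fst_iso]
  exact congrArg Prod.fst (S.iso.apply_symm_apply (1, k))

theorem kerHom_injective : Function.Injective S.kerHom := fun _ _ h ↦
  congrArg Prod.snd (S.iso.symm.injective h)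

theorem exists_kerHom_eq {h : 𝓗.H} (hh : 𝓗.char h = 1) : ∃ k, S.kerHom k = h :=
  ⟨(S.iso h).2, S.iso.symm_apply_eq.2 (Prod.ext ((S.fst_iso h).trans hh).symm rfl)⟩

theorem isHomothetyWith_kerHom_smul (k : 𝓗.char.ker) :
    IsHomothetyWith g g (fun x ↦ S.kerHom k • x) 1 := by
  simpa only [S.char_kerHom, Positive.val_one, one_pow] using 𝓗.homothety (S.kerHom k)

include S in
theorem connectedSpace_ker : ConnectedSpace 𝓗.char.ker :=
  (Prod.snd_surjective.comp S.iso.surjective).connectedSpace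
    (continuous_snd.comp S.contMDiff_iso.continuous)

/-- The hypersurface `g(ξ, ξ) = 1`; it plays the role of `N` in `M ≅ ℝ × N`. -/
def unitLevel : Set M := {x | S.lengthSq x = 1}

theorem lengthSq_coe (n : S.unitLevel) : S.lengthSq (n : M) = 1 := n.2

instance : MulAction 𝓗.char.ker S.unitLevel where
  smul k n := ⟨S.kerHom k • (n : M), by
    change S.lengthSq (S.kerHom k • (n : M)) = 1
    rw [S.lengthSq_smul, S.char_kerHom, S.lengthSq_coe, Positive.val_one, one_pow, one_mul]⟩
  one_smul n := Subtype.ext (by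
    change S.kerHom 1 • (n : M) = n
    rw [map_one, one_smul])
  mul_smul k l n := Subtype.ext (by
    change S.kerHom (k * l) • (n : M) = S.kerHom k • S.kerHom l • (n : M)
    rw [map_mul, mul_smul])

theorem coe_ker_smul (k : 𝓗.char.ker) (n : S.unitLevel) :
    ((k • n : S.unitLevel) : M) = S.kerHom k • (n : M) := rfl

instance : MulAction.IsPretransitive 𝓗.char.ker S.unitLevel := by
  refine ⟨fun x y ↦ ?_⟩
  obtain ⟨h, hh⟩ := MulAction.exists_smul_eq 𝓗.H (x : M) (y : M)
  have hsq : (𝓗.char h : ℝ) ^ 2 = 1 := by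
    have hlen := S.lengthSq_smul h x
    rw [hh, S.lengthSq_coe, S.lengthSq_coe, mul_one] at hlen
    exact hlen.symm
  have hchar : 𝓗.char h = 1 := Subtype.ext ((pow_eq_one_iff_of_nonneg (𝓗.char h).2.le
    two_ne_zero).1 hsq)
  obtain ⟨k, rfl⟩ := S.exists_kerHom_eq hchar
  exact ⟨k, Subtype.ext hh⟩

/-- The parameter `s` for which `Φ_{-s} x` lies on the unit level. -/
def height (x : M) : ℝ := Real.log (S.lengthSq x) / 2

theorem height_flow_smul (s : ℝ) (n : S.unitLevel) : S.height (S.flow s • (n : M)) = s := by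
  rw [height, S.lengthSq_flow_smul, S.lengthSq_coe, mul_one, Real.log_pow, Real.log_exp,
    Nat.cast_ofNat, mul_div_cancel_left₀ _ two_ne_zero]

end UnitLevel

namespace IsSpacelike

variable {E : Type*} [NormedAddCommGroup E] [NormedSpace ℝ E]
  {X : Type*} [TopologicalSpace X] {J : ModelWithCorners ℝ E X}
  {M : Type u} [TopologicalSpace M] [ChartedSpace X M]
  {g : BilinField J M} {𝓗 : HomothetyGroup g} {S : 𝓗.Splitting} (hS : S.IsSpacelike)

include hS

theorem exp_height_sq (x : M) : Real.exp (S.height x) ^ 2 = S.lengthSq x := by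
  rw [← Real.exp_nat_mul, height, Nat.cast_ofNat, mul_div_cancel₀ _ two_ne_zero]
  exact Real.exp_log (hS x)

/-- The projection to the unit level along the flow. -/
def proj (x : M) : S.unitLevel :=
  ⟨S.flow (-S.height x) • x, by
    change S.lengthSq (S.flow (-S.height x) • x) = 1
    rw [S.lengthSq_flow_smul, Real.exp_neg, ← hS.exp_height_sq x, inv_pow,
      inv_mul_cancel₀ (pow_ne_zero 2 (Real.exp_ne_zero _))]⟩

/-- The flow as a bijection `ℝ × N ≃ M`, where `N` is the unit level. -/
def flowEquiv : ℝ × S.unitLevel ≃ M where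
  toFun p := S.flow p.1 • (p.2 : M)
  invFun x := (S.height x, hS.proj x)
  left_inv p := by
    refine Prod.ext (S.height_flow_smul p.1 p.2) (Subtype.ext ?_)
    change S.flow (-S.height (S.flow p.1 • (p.2 : M))) • S.flow p.1 • (p.2 : M) = p.2
    rw [S.height_flow_smul, smul_smul, ← S.flow_add, neg_add_cancel, S.flow_zero, one_smul]
  right_inv x := by
    change S.flow (S.height x) • S.flow (-S.height x) • x = x
    rw [smul_smul, ← S.flow_add, add_neg_cancel, S.flow_zero, one_smul]

theorem faithfulSMul_unitLevel : FaithfulSMul 𝓗.char.ker S.unitLevel := by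
  refine ⟨fun {k l} h ↦ S.kerHom_injective (FaithfulSMul.eq_of_smul_eq_smul fun x : M ↦ ?_)⟩
  obtain ⟨⟨s, n⟩, rfl⟩ := hS.flowEquiv.surjective x
  change S.kerHom k • S.flow s • (n : M) = S.kerHom l • S.flow s • (n : M)
  rw [← S.flow_smul_comm, ← S.flow_smul_comm, ← S.coe_ker_smul, h, S.coe_ker_smul]

variable [IsManifold J ∞ M] (hg : g.IsSmooth)

include hg

theorem contMDiff_height : ContMDiff J 𝓘(ℝ, ℝ) ∞ S.height := fun x ↦
  (contMDiffAt_iff_contDiffAt.2 ((Real.contDiffAt_log.2 (hS x).ne').div_const 2)).comp x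
    (S.contMDiff_lengthSq hg x)

theorem contMDiff_coe_proj : ContMDiff J J ∞ (fun x ↦ (hS.proj x : M)) :=
  S.contMDiff_flow_smul.comp ((hS.contMDiff_height hg).neg.prodMk contMDiff_id)

theorem connectedSpace_unitLevel [ConnectedSpace M] : ConnectedSpace S.unitLevel :=
  (Prod.snd_surjective.comp hS.flowEquiv.symm.surjective).connectedSpace
    (continuous_induced_rng.2 (hS.contMDiff_coe_proj hg).continuous)

end IsSpacelike

open Manifold

section UnitLevelEmbedding

variable {E : Type*} [NormedAddCommGroup E] [NormedSpace ℝ E]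
  {X : Type*} [TopologicalSpace X] {J : ModelWithCorners ℝ E X}
  {M : Type u} [TopologicalSpace M] [ChartedSpace X M]
  {g : BilinField J M} {𝓗 : HomothetyGroup g} {S : 𝓗.Splitting}

variable (S) in
/-- The level hypersurfaces of `g(ξ, ξ)` are non-degenerate: `g` restricts to a non-degenerate form
on the kernel of the differential of `g(ξ, ξ)`. -/
def HasNondegenerateLevels : Prop :=
  ∀ (x : M) (v : TangentSpace J x), mfderiv J 𝓘(ℝ, ℝ) S.lengthSq x v = 0 →
    (∀ w, mfderiv J 𝓘(ℝ, ℝ) S.lengthSq x w = 0 → g x v w = 0) → v = 0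

variable [IsManifold J ∞ M]

theorem hasNondegenerateLevels_of_isRiemannian (hg : g.IsRiemannian) :
    S.HasNondegenerateLevels := fun x v hv h ↦ by
  by_contra hne
  exact (hg.pos x v hne).ne' (h v hv)

section UnitLevelManifold

variable {V : Type*} [NormedAddCommGroup V] [NormedSpace ℝ V] [ChartedSpace V S.unitLevel]
  [IsManifold 𝓘(ℝ, V) ∞ S.unitLevel]
  (hι : IsSmoothEmbedding 𝓘(ℝ, V) J ∞ (Subtype.val : S.unitLevel → M))

include hι

theorem contMDiffSMul_unitLevel :
    ContMDiffSMul 𝓘(ℝ, S.K) 𝓘(ℝ, V) ∞ 𝓗.char.ker S.unitLevel :=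
  ⟨contMDiff_of_comp_isSmoothEmbedding hι ((S.contMDiff_kerHom.comp contMDiff_fst).smul
    (I := 𝓘(ℝ, 𝓗.F)) (hι.contMDiff.comp contMDiff_snd))⟩

theorem mfderiv_coe_ker_smul (k : 𝓗.char.ker) (n : S.unitLevel) (v : TangentSpace 𝓘(ℝ, V) n) :
    mfderiv 𝓘(ℝ, V) J (Subtype.val : S.unitLevel → M) (k • n)
        (mfderiv 𝓘(ℝ, V) 𝓘(ℝ, V) (fun n : S.unitLevel ↦ k • n) n v) =
      mfderiv J J (fun x : M ↦ S.kerHom k • x) n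
        (mfderiv 𝓘(ℝ, V) J (Subtype.val : S.unitLevel → M) n v) := by
  have hcoe := hι.contMDiff.mdifferentiable (by simp)
  have := contMDiffSMul_unitLevel hι
  have hk : ContMDiff 𝓘(ℝ, V) 𝓘(ℝ, V) ∞ (fun n : S.unitLevel ↦ k • n) :=
    ContMDiffSMul.contMDiff_const_smul (I := 𝓘(ℝ, S.K)) k
  have hk' : ContMDiff J J ∞ (fun x : M ↦ S.kerHom k • x) :=
    ContMDiffSMul.contMDiff_const_smul (I := 𝓘(ℝ, 𝓗.F)) (S.kerHom k)
  rw [← mfderiv_comp_apply n (hk'.mdifferentiable (by simp) n) (hcoe n),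
    ← mfderiv_comp_apply n (hcoe (k • n)) (hk.mdifferentiable (by simp) n)]
  rfl

theorem isHomothetyWith_ker_smul (k : 𝓗.char.ker) :
    IsHomothetyWith (g.pullback 𝓘(ℝ, V) (Subtype.val : S.unitLevel → M))
      (g.pullback 𝓘(ℝ, V) (Subtype.val : S.unitLevel → M)) (fun n ↦ k • n) 1 := fun n v w ↦ by
  rw [BilinField.pullback_apply, mfderiv_coe_ker_smul hι, mfderiv_coe_ker_smul hι]
  exact S.isHomothetyWith_kerHom_smul k n _ _

theorem generatorForm_pullback_ker_smul (k : 𝓗.char.ker) (n : S.unitLevel)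
    (v : TangentSpace 𝓘(ℝ, V) n) :
    S.generatorForm.pullback 𝓘(ℝ, V) Subtype.val (k • n)
        (mfderiv 𝓘(ℝ, V) 𝓘(ℝ, V) (fun n : S.unitLevel ↦ k • n) n v) =
      S.generatorForm.pullback 𝓘(ℝ, V) Subtype.val n v := by
  rw [CovectorField.pullback_apply, mfderiv_coe_ker_smul hι, S.coe_ker_smul, generatorForm,
    ← S.mfderiv_smul_generator]
  exact (S.isHomothetyWith_kerHom_smul k n _ _).trans (one_mul _)

omit [IsManifold 𝓘(ℝ, V) ∞ S.unitLevel] in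
theorem mfderiv_lengthSq_mfderiv_coe (hg : g.IsSmooth) (n : S.unitLevel)
    (v : TangentSpace 𝓘(ℝ, V) n) :
    mfderiv J 𝓘(ℝ, ℝ) S.lengthSq n
      (mfderiv 𝓘(ℝ, V) J (Subtype.val : S.unitLevel → M) n v) = 0 := by
  have hconst : S.lengthSq ∘ (Subtype.val : S.unitLevel → M) = fun _ ↦ 1 := funext S.lengthSq_coe
  rw [← mfderiv_comp_apply n ((S.contMDiff_lengthSq hg).mdifferentiable (by simp) n)
    (hι.contMDiff.mdifferentiable (by simp) n), hconst, mfderiv_const]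
  rfl

namespace IsSpacelike

variable (hS : S.IsSpacelike) (hg : g.IsSmooth)

/-- The flow as a diffeomorphism from `ℝ × N` to `M`, where `N` is the unit level. -/
def flowDiffeo : Diffeomorph (𝓘(ℝ, ℝ).prod 𝓘(ℝ, V)) J (ℝ × S.unitLevel) M ∞ where
  toEquiv := hS.flowEquiv
  contMDiff_toFun :=
    S.contMDiff_flow_smul.comp (contMDiff_fst.prodMk (hι.contMDiff.comp contMDiff_snd))
  contMDiff_invFun := (hS.contMDiff_height hg).prodMk
    (contMDiff_of_comp_isSmoothEmbedding hι (hS.contMDiff_coe_proj hg))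

theorem mfderiv_flowDiffeo (s a : ℝ) (n : S.unitLevel) (v : TangentSpace 𝓘(ℝ, V) n) :
    mfderiv (𝓘(ℝ, ℝ).prod 𝓘(ℝ, V)) J (hS.flowDiffeo hι hg) (s, n) (a, v) =
      mfderiv J J (fun x : M ↦ S.flow s • x) n (a • S.generator n +
        mfderiv 𝓘(ℝ, V) J (Subtype.val : S.unitLevel → M) n v) := by
  have hid : HasMFDerivAt 𝓘(ℝ, ℝ) 𝓘(ℝ, ℝ) (id : ℝ → ℝ) s (ContinuousLinearMap.id ℝ ℝ) :=
    hasMFDerivAt_id s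
  have hprod := HasMFDerivAt.prodMap (p := (s, n)) hid
    (hι.contMDiff.mdifferentiable (by simp) n).hasMFDerivAt
  have hcomp := mfderiv_comp_apply (s, n)
    (S.contMDiff_flow_smul.mdifferentiable (by simp) (s, (n : M))) hprod.mdifferentiableAt (a, v)
  rw [← S.mfderiv_flow_smul]
  refine hcomp.trans ?_
  rw [hprod.mfderiv, hid.mfderiv]
  rfl

include hS hg

theorem mfderiv_coe_injective (n : S.unitLevel) :
    Function.Injective (mfderiv 𝓘(ℝ, V) J (Subtype.val : S.unitLevel → M) n) := by
  intro v w hvw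
  have h := (hS.mfderiv_flowDiffeo hι hg 0 0 n v).trans
    ((congrArg (fun u ↦ mfderiv J J (fun x : M ↦ S.flow 0 • x) n (0 • S.generator n + u))
      hvw).trans (hS.mfderiv_flowDiffeo hι hg 0 0 n w).symm)
  exact congrArg Prod.snd
    (((hS.flowDiffeo hι hg).mfderivToContinuousLinearEquiv (by simp) (0, n)).injective h)

theorem exists_mfderiv_coe_eq (n : S.unitLevel) {w : TangentSpace J (n : M)}
    (hw : mfderiv J 𝓘(ℝ, ℝ) S.lengthSq n w = 0) :
    ∃ v, mfderiv 𝓘(ℝ, V) J (Subtype.val : S.unitLevel → M) n v = w := by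
  obtain ⟨⟨a, v⟩, h⟩ := mfderiv_surjective_of_diffeomorph (hS.flowDiffeo hι hg) (0, n)
    (mfderiv J J (fun x : M ↦ S.flow 0 • x) n w)
  have hinj : Function.Injective (mfderiv J J (fun x : M ↦ S.flow 0 • x) n) :=
    ((Diffeomorph.smul 𝓘(ℝ, 𝓗.F) J ∞ (S.flow 0) : Diffeomorph J J M M ∞)
      |>.mfderivToContinuousLinearEquiv (by simp) n).injective
  have hdecomp := hinj ((hS.mfderiv_flowDiffeo hι hg 0 a n v).symm.trans h)
  have ha : a = 0 := by
    let L : E →L[ℝ] ℝ := mfderiv J 𝓘(ℝ, ℝ) S.lengthSq n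
    let ξ : E := S.generator (n : M)
    let v' : E := mfderiv 𝓘(ℝ, V) J (Subtype.val : S.unitLevel → M) n v
    have hξ : L ξ = 2 * S.lengthSq n := S.mfderiv_lengthSq_generator hg n
    have hv : L v' = 0 := mfderiv_lengthSq_mfderiv_coe hι hg n v
    have hsum : L (a • ξ + v') = 0 := (congrArg L hdecomp).trans hw
    rw [map_add, map_smul, hξ, hv, S.lengthSq_coe, smul_eq_mul] at hsum
    linarith
  exact ⟨v, by rwa [ha, zero_smul, zero_add] at hdecomp⟩

end IsSpacelike

end UnitLevelManifold

end UnitLevelEmbedding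

namespace IsSpacelike

section QStructure

variable {E : Type*} [NormedAddCommGroup E] [NormedSpace ℝ E]
  {X : Type*} [TopologicalSpace X] {J : ModelWithCorners ℝ E X}
  {M : Type u} [TopologicalSpace M] [ChartedSpace X M] [IsManifold J ∞ M]
  {g : BilinField J M} {𝓗 : HomothetyGroup g} {S : 𝓗.Splitting}
  {V : Type} [NormedAddCommGroup V] [NormedSpace ℝ V] [FiniteDimensional ℝ V]
  [ChartedSpace V S.unitLevel] [IsManifold 𝓘(ℝ, V) ∞ S.unitLevel]
  (hι : IsSmoothEmbedding 𝓘(ℝ, V) J ∞ (Subtype.val : S.unitLevel → M))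
  (hS : S.IsSpacelike) (hg : g.IsPseudoRiemannian) (hlev : S.HasNondegenerateLevels)

include hι hS hg hlev in
theorem isPseudoRiemannian_pullback_coe :
    (g.pullback 𝓘(ℝ, V) (Subtype.val : S.unitLevel → M)).IsPseudoRiemannian where
  smooth := BilinField.IsSmooth.pullback hg.isSmooth hι.contMDiff
  symm _ _ _ := hg.symm _ _ _
  nondegenerate n v hv := by
    have hv₀ : mfderiv 𝓘(ℝ, V) J (Subtype.val : S.unitLevel → M) n v = 0 :=
      hlev n _ (mfderiv_lengthSq_mfderiv_coe hι hg.isSmooth n v) fun w hw ↦ by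
        obtain ⟨w, rfl⟩ := hS.exists_mfderiv_coe_eq hι hg.isSmooth n hw
        exact hv w
    exact hS.mfderiv_coe_injective hι hg.isSmooth n (hv₀.trans (map_zero _).symm)

omit [FiniteDimensional ℝ V] in
theorem apply_mfderiv_flowDiffeo (s a b : ℝ) (n : S.unitLevel) (v w : TangentSpace 𝓘(ℝ, V) n) :
    g (S.flow s • (n : M))
        (mfderiv (𝓘(ℝ, ℝ).prod 𝓘(ℝ, V)) J (hS.flowDiffeo hι hg.isSmooth) (s, n) (a, v))
        (mfderiv (𝓘(ℝ, ℝ).prod 𝓘(ℝ, V)) J (hS.flowDiffeo hι hg.isSmooth) (s, n) (b, w)) =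
      Real.exp (2 * s) * (a * b + (a * S.generatorForm.pullback 𝓘(ℝ, V) Subtype.val n w +
        b * S.generatorForm.pullback 𝓘(ℝ, V) Subtype.val n v) +
          g.pullback 𝓘(ℝ, V) (Subtype.val : S.unitLevel → M) n v w) := by
  let B : E →L[ℝ] E →L[ℝ] ℝ := g (n : M)
  let ξ : E := S.generator (n : M)
  let v' : E := mfderiv 𝓘(ℝ, V) J (Subtype.val : S.unitLevel → M) n v
  let w' : E := mfderiv 𝓘(ℝ, V) J (Subtype.val : S.unitLevel → M) n w
  have hunit : B ξ ξ = 1 := S.lengthSq_coe n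
  have hsymm : B v' ξ = B ξ v' := hg.symm n v' ξ
  rw [hS.mfderiv_flowDiffeo hι, hS.mfderiv_flowDiffeo hι]
  refine (𝓗.homothety (S.flow s) n _ _).trans ?_
  rw [S.char_flow, ← Real.exp_nat_mul, Nat.cast_ofNat]
  change Real.exp (2 * s) * B (a • ξ + v') (b • ξ + w') =
    Real.exp (2 * s) * (a * b + (a * B ξ w' + b * B ξ v') + B v' w')
  simp only [map_add, map_smul, add_apply, smul_apply, smul_eq_mul, hunit, hsymm]
  ring

variable [FiniteDimensional ℝ E] [T2Space M] [SecondCountableTopology M] [ConnectedSpace M]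

/-- The `𝔔`-structure on the unit level `N`: the metric and `θ` are the restrictions of `g` and
`ξ♭`, and the group is the kernel of the homothety character. -/
def qStructure : QStructure.{u} where
  E := V
  N := S.unitLevel
  secondCountableTopologyN := Topology.IsInducing.subtypeVal.secondCountableTopology
  connectedSpaceN := hS.connectedSpace_unitLevel hg.isSmooth
  g := g.pullback 𝓘(ℝ, V) Subtype.val
  isPseudoRiemannian := hS.isPseudoRiemannian_pullback_coe hι hg hlev
  F := S.K
  G := 𝓗.char.ker
  connectedSpaceG := S.connectedSpace_ker
  contMDiffSMul := contMDiffSMul_unitLevel hι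
  faithfulSMul := hS.faithfulSMul_unitLevel
  isometry := isHomothetyWith_ker_smul hι
  θ := S.generatorForm.pullback 𝓘(ℝ, V) Subtype.val
  smooth_θ := (S.isSmooth_generatorForm hg.isSmooth).pullback hι.contMDiff
  invariant_θ := generatorForm_pullback_ker_smul hι

theorem isHomothetyWith_flowDiffeo :
    IsHomothetyWith ((hS.qStructure hι hg hlev).metric 2) g (hS.flowDiffeo hι hg.isSmooth) 1 := by
  rintro ⟨s, n⟩ ⟨a, v⟩ ⟨b, w⟩
  have hmetric := (hS.qStructure hι hg hlev).metric_apply 2 (s, n) (a, v) (b, w)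
  rw [one_mul]
  exact (hS.apply_mfderiv_flowDiffeo hι hg s a b n v w).trans hmetric.symm

end QStructure

variable {E : Type*} [NormedAddCommGroup E] [NormedSpace ℝ E] [FiniteDimensional ℝ E]
  {M : Type u} [TopologicalSpace M] [ChartedSpace E M]
  {g : BilinField 𝓘(ℝ, E) M} {𝓗 : HomothetyGroup g} {S : 𝓗.Splitting}

theorem finrank_pos [Nonempty M] (hS : S.IsSpacelike) : 0 < Module.finrank ℝ E := by
  obtain ⟨x⟩ := ‹Nonempty M›
  exact Module.finrank_pos_iff_exists_ne_zero.2 ⟨S.generator x, fun h ↦ (hS x).ne'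
    ((congrArg (fun v : E ↦ (g x : E →L[ℝ] E →L[ℝ] ℝ) v v) h).trans (map_zero _))⟩

variable [IsManifold 𝓘(ℝ, E) ∞ M]

theorem exists_isSmoothEmbedding_unitLevel [Nonempty M] (hS : S.IsSpacelike) (hg : g.IsSmooth) :
    ∃ _ : ChartedSpace (EuclideanSpace ℝ (Fin (Module.finrank ℝ E - 1))) S.unitLevel,
      IsManifold (𝓡 (Module.finrank ℝ E - 1)) ∞ S.unitLevel ∧
      IsSmoothEmbedding (𝓡 (Module.finrank ℝ E - 1)) 𝓘(ℝ, E) ∞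
        (Subtype.val : S.unitLevel → M) := by
  refine exists_isSmoothEmbedding_levelSet ?_ (by simp) (S.contMDiff_lengthSq hg) 1
    fun p _ ↦ S.mfderiv_lengthSq_surjective hg (hS p).ne'
  rw [finrank_euclideanSpace_fin, Module.finrank_self, Nat.sub_add_cancel hS.finrank_pos]

theorem exists_areIsometric_metric [T2Space M] [SecondCountableTopology M] [ConnectedSpace M]
    (hS : S.IsSpacelike) (hg : g.IsPseudoRiemannian) (hlev : S.HasNondegenerateLevels) :
    ∃ Q : QStructure.{u}, (∀ y : Q.N, Q.g.dualNormSq Q.θ y ≠ 1) ∧ AreIsometric g (Q.metric 2) := by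
  obtain ⟨_, _, hι⟩ := hS.exists_isSmoothEmbedding_unitLevel hg.isSmooth
  have hT := hS.isHomothetyWith_flowDiffeo hι hg hlev
  exact ⟨hS.qStructure hι hg hlev,
    (QStructure.nondegenerate_metric_iff _ 2).1 (hg.nondegenerate.of_isHomothetyWith hT),
    AreIsometric.symm ⟨_, hT⟩⟩

end IsSpacelike

end HomothetyGroup.Splitting

end

theorem theorem1p10_general :
    (∀ (Q : QStructure.{u}) (t : ℝ),
      ((Q.metric t).Nondegenerate ↔ ∀ y : Q.N, Q.g.dualNormSq Q.θ y ≠ 1) ∧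
      ((∀ y : Q.N, Q.g.dualNormSq Q.θ y ≠ 1) → (Q.metric t).IsPseudoRiemannian) ∧
      IsHomothetyHomogeneous (Q.metric t) ∧
      (t ≠ 0 → ∃ 𝓗 : HomothetyGroup (Q.metric t), 𝓗.char ≠ 1 ∧ Nonempty 𝓗.Splitting)) ∧
    (∀ (E : Type*) [NormedAddCommGroup E] [NormedSpace ℝ E] [FiniteDimensional ℝ E]
      (M : Type u) [TopologicalSpace M] [ChartedSpace E M] [IsManifold 𝓘(ℝ, E) ∞ M]
      [T2Space M] [SecondCountableTopology M] [ConnectedSpace M]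
      (g : BilinField 𝓘(ℝ, E) M) (𝓗 : HomothetyGroup g) (S : 𝓗.Splitting),
      g.IsPseudoRiemannian → S.HasNondegenerateLevels → S.IsSpacelike →
        ∃ (Q : QStructure.{u}) (t : ℝ), t ≠ 0 ∧ (∀ y : Q.N, Q.g.dualNormSq Q.θ y ≠ 1) ∧
          AreIsometric g (Q.metric t)) := by
  refine ⟨fun Q t ↦ ⟨Q.nondegenerate_metric_iff t, Q.isPseudoRiemannian_metric t,
    Q.isHomothetyHomogeneous_metric t, fun ht ↦ ⟨Q.homothetyGroup ht,
      Q.char_homothetyGroup_ne_one ht, ⟨Q.homothetySplitting ht⟩⟩⟩, ?_⟩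
  intro E _ _ _ M _ _ _ _ _ _ g 𝓗 S hg hlev hS
  obtain ⟨Q, hQ, hiso⟩ := hS.exists_areIsometric_metric hg hlev
  exact ⟨Q, 2, two_ne_zero, hQ, hiso⟩

theorem theorem1p10 :
    (∀ (Q : QStructure.{u}) (t : ℝ),
      ((Q.metric t).Nondegenerate ↔ ∀ y : Q.N, Q.g.dualNormSq Q.θ y ≠ 1) ∧
      ((∀ y : Q.N, Q.g.dualNormSq Q.θ y ≠ 1) →
        (Q.metric t).IsPseudoRiemannian ∧
        IsHomothetyHomogeneous (Q.metric t) ∧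
        (t ≠ 0 → ∃ 𝓗 : HomothetyGroup (Q.metric t), 𝓗.char ≠ 1 ∧ Nonempty 𝓗.Splitting))) ∧
    (∀ (E : Type) [NormedAddCommGroup E] [NormedSpace ℝ E] [FiniteDimensional ℝ E]
      (M : Type u) [TopologicalSpace M] [ChartedSpace E M] [IsManifold 𝓘(ℝ, E) ∞ M]
      [T2Space M] [SecondCountableTopology M] [ConnectedSpace M]
      (g : BilinField 𝓘(ℝ, E) M) (𝓗 : HomothetyGroup g) (S : 𝓗.Splitting),
      g.IsRiemannian → 𝓗.char ≠ 1 → ¬ g.IsVSI → S.IsSpacelike →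
        ∃ (Q : QStructure.{u}) (t : ℝ), t ≠ 0 ∧ (∀ y : Q.N, Q.g.dualNormSq Q.θ y ≠ 1) ∧
          AreIsometric g (Q.metric t)) := by
  refine ⟨fun Q t ↦ ?_, fun E _ _ _ M _ _ _ _ _ _ g 𝓗 S hg _ _ ↦
    theorem1p10_general.2 E M g 𝓗 S hg.toIsPseudoRiemannian
      (HomothetyGroup.Splitting.hasNondegenerateLevels_of_isRiemannian hg)⟩
  obtain ⟨hnondeg, hpseudo, hrest⟩ := theorem1p10_general.{u, 0}.1 Q t
  exact ⟨hnondeg, fun h ↦ ⟨hpseudo h, hrest⟩⟩
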